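/- Let $\mathsf k$ be a field and let $I\subseteq \mathsf k[x,y]$ be a monomial ideal that is not principal. For a monomial ideal $J$ let $\mathsf G(J)$ be its set of minimal monomial generators, $\mu(J)=|\mathsf G(J)|$, and for $\bullet\in\{x,y\}$ let $\operatorname{dist}_\bullet(J)$ be the maximal $\bullet$-degree of an element of $\mathsf G(J:\gcd(J))$, where $\gcd(J)$ is the greatest common divisor of the monomials in $J$; for monomials $g,h$ put $\operatorname{dist}_\bullet(g,h)=\operatorname{dist}_\bullet((g,h))$. A monomial $f$ is in the integral closure $\overline J$ if $f^n\in J^n$ for some $n\ge 1$. Let $P(I)$ be the set of those $f\in\mathsf G(I)$ with $f\notin\overline{(g,h)}$ for all monomials $g,h\in I\setminus\{f\}$, and let $P^*(I)$ be the set of those $f\in \mathsf G(I)$ with $f^n\in\mathsf G(I^n)$ for all $n\ge1$. Let $P=\{g_1,\dots,g_{k+1}\}$, ordered by strictly descending $y$-degree, satisfy $P(I)\subseteq P\subseteq P^*(I)$. Put $$\delta_P=\max_{1\le i\le k}\min\{\operatorname{dist}_x(g_i,g_{i+1}),\operatorname{dist}_y(g_i,g_{i+1})\}-1,$$ $d_P=\min\{\operatorname{dist}_x(I),\operatorname{dist}_y(I)\}-2$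 if $|P|>2$ and $d_P=0$ if $|P|=2$, and $D_P=(\mu(I)-|P|)\,\delta_P+|P|\,d_P$. For an integer $D\ge D_P$ put $$r_\bullet(P,D)=\left\lceil D\cdot\max_{1\le i\le k}\frac{\operatorname{dist}_\bullet(I)}{\operatorname{dist}_\bullet(g_i,g_{i+1})}\right\rceil\quad(\bullet\in\{x,y\}),\qquad r(P,D)=\min\{r_x(P,D),r_y(P,D)\}.$$ (1) For every integer $D\ge D_P$, every integer $s\ge D+r(P,D)+1$ and every $\ell\ge0$, $$\mu(I^{s+\ell})=\mu(I^s)+\ell\left(\mu(I^{s+1})-\mu(I^s)\right).$$ (2) For $\bullet\in\{x,y\}$, $D_P+r_\bullet(P,D_P)+1\le\mu(I)\left(\operatorname{dist}_\bullet(I)^2-1\right)+1$. (3) Consequently, for $\bullet\in\{x,y\}$, the formula in (1) holds for every integer $s\ge \mu(I)\left(\operatorname{dist}_\bullet(I)^2-1\right)+1$ and every $\ell\ge0$. -/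

import Mathlib

open MvPolynomial

namespace BivariateMonomial

/-- Exponent vectors of monomials in two variables: the monomial `x ^ a * y ^ b` is the vector
with value `a` at `0` and `b` at `1`. The index `0` stands for `x`, the index `1` for `y`. -/
abbrev Mon : Type := Fin 2 →₀ ℕ

variable (K : Type*) [Field K]

/-- The monomial with exponent vector `a`, as an element of `K[x, y]`. -/
noncomputable def mon (a : Mon) : MvPolynomial (Fin 2) K := monomial a 1

variable {K}

/-- A monomial ideal is an ideal generated by monomials. -/
def IsMonomialIdeal (I : Ideal (MvPolynomial (Fin 2) K)) : Prop :=
  ∃ S : Set Mon, I = Ideal.span (mon K '' S)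

/-- `G(I)`: the minimal monomial generators of `I`, i.e. the monomials of `I` that are minimal
with respect to divisibility. -/
def minGens (I : Ideal (MvPolynomial (Fin 2) K)) : Set Mon :=
  {a | mon K a ∈ I ∧ ∀ b : Mon, mon K b ∈ I → b ≤ a → b = a}

/-- `μ(I)`: the number of minimal generators of a monomial ideal. -/
noncomputable def mu (I : Ideal (MvPolynomial (Fin 2) K)) : ℕ := (minGens I).ncard

/-- The exponent vector of `gcd(I)`, the greatest common divisor of all monomials in `I`. -/
noncomputable def gcdExp (I : Ideal (MvPolynomial (Fin 2) K)) : Mon :=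
  Finsupp.equivFunOnFinite.symm fun v => sInf {n : ℕ | ∃ a : Mon, mon K a ∈ I ∧ a v = n}

/-- The anchored ideal `I : gcd(I)`. -/
noncomputable def anchor (I : Ideal (MvPolynomial (Fin 2) K)) : Ideal (MvPolynomial (Fin 2) K) :=
  I.colon {mon K (gcdExp I)}

/-- The `x`-distance (`v = 0`) or `y`-distance (`v = 1`) of `I`: the maximal degree in that
variable of a minimal generator of `I : gcd(I)`. -/
noncomputable def dist (v : Fin 2) (I : Ideal (MvPolynomial (Fin 2) K)) : ℕ :=
  sSup ((fun a : Mon => a v) '' minGens (anchor I))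

variable (K) in
/-- The distance of a pair of monomials: the distance of the ideal that they generate. -/
noncomputable def pairDist (v : Fin 2) (g h : Mon) : ℕ :=
  dist v (Ideal.span {mon K g, mon K h})

/-- The monomials in the integral closure of `I`: those with a positive power `n` such that the
`n`-th power of the monomial lies in `I ^ n`. -/
def integralClosureMon (I : Ideal (MvPolynomial (Fin 2) K)) : Set Mon :=
  {f | ∃ n : ℕ, 0 < n ∧ mon K f ^ n ∈ I ^ n}

/-- `P(I)`: the persistent generators of `I`. -/
def persistentGens (I : Ideal (MvPolynomial (Fin 2) K)) : Set Mon :=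
  {f | f ∈ minGens I ∧ ∀ g h : Mon, mon K g ∈ I → g ≠ f → mon K h ∈ I → h ≠ f →
    f ∉ integralClosureMon (Ideal.span {mon K g, mon K h})}

/-- `P*(I)`: the weakly persistent generators of `I`
(`n • f` is the exponent vector of the `n`-th power). -/
def weaklyPersistentGens (I : Ideal (MvPolynomial (Fin 2) K)) : Set Mon :=
  {f | f ∈ minGens I ∧ ∀ n : ℕ, 0 < n → n • f ∈ minGens (I ^ n)}

/-- `P = {g 0, …, g m}` is a set of monomials with `P(I) ⊆ P ⊆ P*(I)`, listed in strictly
descending `y`-degree. In particular `P` has `m + 1` elements. -/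
def IsAdmissible (I : Ideal (MvPolynomial (Fin 2) K)) {m : ℕ} (g : Fin (m + 1) → Mon) : Prop :=
  (∀ i j, i < j → g j 1 < g i 1) ∧
    persistentGens I ⊆ Set.range g ∧ Set.range g ⊆ weaklyPersistentGens I

variable (K) in
/-- `δ_P`: one less than the maximum, over consecutive elements of `P`, of the minimum of their
`x`- and `y`-distance. -/
noncomputable def delta {m : ℕ} (g : Fin (m + 1) → Mon) : ℕ :=
  (Finset.univ.sup fun i : Fin m =>
    min (pairDist K 0 (g i.castSucc) (g i.succ)) (pairDist K 1 (g i.castSucc) (g i.succ))) - 1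

/-- `d_P`, for a set `P` with `m + 1` elements. -/
noncomputable def dOf (I : Ideal (MvPolynomial (Fin 2) K)) (m : ℕ) : ℕ :=
  if 2 < m + 1 then min (dist 0 I) (dist 1 I) - 2 else 0

/-- `D_P = (μ(I) - |P|) δ_P + |P| d_P`. -/
noncomputable def bigD (I : Ideal (MvPolynomial (Fin 2) K)) {m : ℕ} (g : Fin (m + 1) → Mon) : ℕ :=
  (mu I - (m + 1)) * delta K g + (m + 1) * dOf I m

/-- `r_x(P, D)` for `v = 0` and `r_y(P, D)` for `v = 1`: the rounded-up product of `D` with the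
maximum, over consecutive elements of `P`, of the quotient of the distance of `I` by the distance
of the pair. -/
noncomputable def rDir (v : Fin 2) (I : Ideal (MvPolynomial (Fin 2) K)) {m : ℕ}
    (g : Fin (m + 1) → Mon) (D : ℕ) : ℕ :=
  ⌈(D : ℚ≥0) * Finset.univ.sup fun i : Fin m =>
    (dist v I : ℚ≥0) / (pairDist K v (g i.castSucc) (g i.succ) : ℚ≥0)⌉₊

/-- `r(P, D) = min {r_x(P, D), r_y(P, D)}`. -/
noncomputable def rMin (I : Ideal (MvPolynomial (Fin 2) K)) {m : ℕ}
    (g : Fin (m + 1) → Mon) (D : ℕ) : ℕ :=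
  min (rDir 0 I g D) (rDir 1 I g D)

end BivariateMonomial

/-! Everything happens on exponent vectors. The elements of `P` lie on the compact boundary of the
Newton polyhedron and include its vertices (`IsFrame`); every other generator lies above a segment
between two consecutive elements `g i`, `g (i+1)`.

Decomposition (`IsFrame.decomposes`). If a generator outside the frame occurs too often in a
product, a block of its copies can be traded for the ends of its segment, and two outer frame
elements can be traded for one between them; neither trade increases the exponents. What remains is
large only on one consecutive pair, so every monomial of the power `D + n` is divisible by a
monomial of the power `D` times `n` factors from `{g i, g (i+1)}`.

Translation. The part from the power `D` has bounded degree. Once `k > r`, degree alone therefore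
forces a factor `g i` in the minimal generators of the power `D + k + 1` below a cut in the segment
from `g i` to `g (i+1)`, and a factor `g (i+1)` in those above it (`add_left_mem`, `add_right_mem`).
Passing to the next power thus shifts both sides and inserts one window of width `g (i+1) - g i` at
the cut (`cnt_segment`). That window recurs, translated, in the next power (`cnt_period`). So the
second difference of `μ` vanishes.

The explicit bound is arithmetic on the distances. Its consequence for all monomial ideals takes the
weakly persistent generators as frame. -/

namespace BivariateMonomial

/-! ### Powers of monomial ideals as sums of exponent vectors. -/

/-- Sums of `n` elements of `G`, with repetition. -/
def sumsOf (G : Set Mon) (n : ℕ) : Set Mon :=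
  {a | ∃ s : Multiset Mon, s.card = n ∧ (∀ h ∈ s, h ∈ G) ∧ s.sum = a}

/-- The exponent vectors of the monomials in the `n`-th power of the ideal generated by `G`. -/
def powExp (G : Set Mon) (n : ℕ) : Set Mon := {a | ∃ b ∈ sumsOf G n, b ≤ a}

/-- The minimal elements of `powExp G n`. -/
def minExp (G : Set Mon) (n : ℕ) : Set Mon :=
  {a | a ∈ powExp G n ∧ ∀ b ∈ powExp G n, b ≤ a → b = a}

theorem eq_or_eq_of_ne {v w : Fin 2} (h : v ≠ w) (i : Fin 2) : i = v ∨ i = w := by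
  omega

theorem mon_le_iff {v w : Fin 2} (h : v ≠ w) {a b : Mon} : a ≤ b ↔ a v ≤ b v ∧ a w ≤ b w := by
  refine ⟨fun H => ⟨H v, H w⟩, fun H i => ?_⟩
  rcases eq_or_eq_of_ne h i with rfl | rfl
  exacts [H.1, H.2]

theorem mon_eq_iff {v w : Fin 2} (h : v ≠ w) {a b : Mon} : a = b ↔ a v = b v ∧ a w = b w := by
  rw [le_antisymm_iff, mon_le_iff h, mon_le_iff h]
  omega

theorem sumsOf_add {G : Set Mon} {n k : ℕ} {a b : Mon} (ha : a ∈ sumsOf G n)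
    (hb : b ∈ sumsOf G k) : a + b ∈ sumsOf G (n + k) := by
  obtain ⟨s, hs, hsG, rfl⟩ := ha
  obtain ⟨t, ht, htG, rfl⟩ := hb
  refine ⟨s + t, by simp [hs, ht], fun h hh => ?_, by simp⟩
  rcases Multiset.mem_add.1 hh with hh | hh
  exacts [hsG h hh, htG h hh]

theorem sumsOf_subset_powExp (G : Set Mon) (n : ℕ) : sumsOf G n ⊆ powExp G n :=
  fun a ha => ⟨a, ha, le_rfl⟩

theorem powExp_add {G : Set Mon} {n k : ℕ} {a b : Mon} (ha : a ∈ powExp G n)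
    (hb : b ∈ powExp G k) : a + b ∈ powExp G (n + k) := by
  obtain ⟨a', ha', hle⟩ := ha
  obtain ⟨b', hb', hle'⟩ := hb
  exact ⟨a' + b', sumsOf_add ha' hb', add_le_add hle hle'⟩

theorem nsmul_mem_sumsOf {G : Set Mon} {z : Mon} (hz : z ∈ G) (n : ℕ) : n • z ∈ sumsOf G n :=
  ⟨Multiset.replicate n z, by simp, fun h hh => by rwa [Multiset.eq_of_mem_replicate hh], by simp⟩

theorem mem_sumsOf_one {G : Set Mon} {z : Mon} (hz : z ∈ G) : z ∈ sumsOf G 1 := by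
  simpa using nsmul_mem_sumsOf hz 1

theorem exists_minExp_le {G : Set Mon} {n : ℕ} {a : Mon} (ha : a ∈ powExp G n) :
    ∃ b ∈ minExp G n, b ≤ a := by
  induction h : a 0 + a 1 using Nat.strong_induction_on generalizing a with
  | _ k ih =>
    by_cases hm : a ∈ minExp G n
    · exact ⟨a, hm, le_rfl⟩
    · have : ∃ b ∈ powExp G n, b ≤ a ∧ b ≠ a := by
        by_contra! hc
        exact hm ⟨ha, hc⟩
      obtain ⟨b, hb, hba, hne⟩ := this
      have h1 := (mon_le_iff (zero_ne_one)).1 hba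
      have h2 := mt (mon_eq_iff (a := b) (b := a) (zero_ne_one)).2 hne
      obtain ⟨c, hc, hcb⟩ := ih (b 0 + b 1) (by omega) hb rfl
      exact ⟨c, hc, hcb.trans hba⟩

theorem minExp_subset_sumsOf (G : Set Mon) (n : ℕ) : minExp G n ⊆ sumsOf G n := by
  rintro a ⟨⟨b, hb, hba⟩, h⟩
  rwa [← h b (sumsOf_subset_powExp G n hb) hba]

theorem sumsOf_finite {G : Set Mon} (hG : G.Finite) (n : ℕ) : (sumsOf G n).Finite := by
  induction n with
  | zero =>
    refine (Set.finite_singleton (0 : Mon)).subset ?_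
    rintro a ⟨s, hs, -, rfl⟩
    simp [Multiset.card_eq_zero.1 hs]
  | succ n ih =>
    refine (Set.Finite.image2 (fun a b : Mon => a + b) hG ih).subset ?_
    rintro a ⟨s, hs, hsG, rfl⟩
    obtain ⟨z, hz⟩ := Multiset.card_pos_iff_exists_mem.1 (show 0 < s.card by omega)
    obtain ⟨t, rfl⟩ := Multiset.exists_cons_of_mem hz
    refine ⟨z, hsG z hz, t.sum, ⟨t, by simpa using hs, fun h hh => hsG h (by simp [hh]), rfl⟩,
      by simp⟩

theorem minExp_finite {G : Set Mon} (hG : G.Finite) (n : ℕ) : (minExp G n).Finite :=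
  (sumsOf_finite hG n).subset (minExp_subset_sumsOf G n)

theorem minExp_of_add {G : Set Mon} {n : ℕ} {f z : Mon} (hz : z ∈ G) (hf : f ∈ powExp G n)
    (h : f + z ∈ minExp G (n + 1)) : f ∈ minExp G n := by
  refine ⟨hf, fun b hb hbf => ?_⟩
  have := h.2 (b + z) (powExp_add hb (sumsOf_subset_powExp _ _ (mem_sumsOf_one hz)))
    (add_le_add hbf le_rfl)
  exact add_right_cancel this

theorem minExp_lt {G : Set Mon} {n : ℕ} {v w : Fin 2} (h : v ≠ w) {a b : Mon}
    (ha : a ∈ minExp G n) (hb : b ∈ minExp G n) (hab : a v < b v) : b w < a w := by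
  by_contra! hc
  have := hb.2 a ha.1 ((mon_le_iff h).2 ⟨hab.le, hc⟩)
  subst this
  omega

theorem minExp_le {G : Set Mon} {n : ℕ} {v w : Fin 2} (h : v ≠ w) {a b : Mon}
    (ha : a ∈ minExp G n) (hb : b ∈ minExp G n) (hab : a v ≤ b v) : b w ≤ a w := by
  by_contra! hc
  have := hb.2 a ha.1 ((mon_le_iff h).2 ⟨hab, hc.le⟩)
  subst this
  omega

theorem multiset_sum_bounds {v : Fin 2} {lo hi : ℕ} (s : Multiset Mon)
    (h : ∀ z ∈ s, lo ≤ z v ∧ z v ≤ hi) : s.card * lo ≤ s.sum v ∧ s.sum v ≤ s.card * hi := by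
  induction s using Multiset.induction_on with
  | empty => simp
  | cons a s ih =>
    have h1 := ih fun z hz => h z (by simp [hz])
    have h2 := h a (by simp)
    simp only [Multiset.card_cons, Multiset.sum_cons, Finsupp.add_apply, add_mul, one_mul]
    omega

/-! ### Frames: convexity along the Newton boundary. -/

/-- A family of elements of an antichain `G`, strictly ascending in the coordinate `v`, that lie on
the compact boundary of the Newton polyhedron of `G` and include its vertices. -/
structure IsFrame (G : Set Mon) (v w : Fin 2) {m : ℕ} (g : Fin (m + 1) → Mon) : Prop where
  ne : v ≠ w
  finite : G.Finite
  antichain : ∀ a ∈ G, ∀ b ∈ G, a ≤ b → a = b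
  mono : StrictMono fun i => g i v
  weak : ∀ i n, 0 < n → n • g i ∈ minExp G n
  mem : ∀ i, g i ∈ G
  support : ∀ p q : ℕ, 0 < p → 0 < q →
    ∃ i, ∀ z ∈ G, p * g i v + q * g i w ≤ p * z v + q * z w

namespace IsFrame

variable {G : Set Mon} {v w : Fin 2} {m : ℕ} {g : Fin (m + 1) → Mon}

theorem lt_of_lt (hF : IsFrame G v w g) {a b : Mon} (ha : a ∈ G) (hb : b ∈ G) (h : a v < b v) :
    b w < a w := by
  by_contra! hc
  have := hF.antichain a ha b hb ((mon_le_iff hF.ne).2 ⟨h.le, hc⟩)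
  subst this
  omega

theorem anti (hF : IsFrame G v w g) {i j : Fin (m + 1)} (h : i < j) : g j w < g i w :=
  hF.lt_of_lt (hF.mem i) (hF.mem j) (hF.mono h)

theorem swap (hF : IsFrame G v w g) : IsFrame G w v (g ∘ Fin.rev) where
  ne := hF.ne.symm
  finite := hF.finite
  antichain := hF.antichain
  mono i j h := hF.anti (Fin.rev_lt_rev.2 h)
  weak i := hF.weak _
  mem i := hF.mem _
  support p q hp hq := by
    obtain ⟨i, hi⟩ := hF.support q p hq hp
    refine ⟨i.rev, fun z hz => ?_⟩
    have := hi z hz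
    simp only [Function.comp_apply, Fin.rev_rev]
    omega

theorem zero_le (hF : IsFrame G v w g) {z : Mon} (hz : z ∈ G) : g 0 v ≤ z v := by
  by_contra! hc
  -- The weight on `v` is so steep that one unit of `v`-degree outweighs all of `z w`, so the
  -- minimizer cannot lie to the right of `z`.
  obtain ⟨i, hi⟩ := hF.support (z w + 1) 1 (by omega) one_pos
  have h1 := hi z hz
  have h2 : g 0 v ≤ g i v := hF.mono.monotone (Fin.zero_le i)
  have h3 : (z w + 1) * (z v + 1) ≤ (z w + 1) * g i v := Nat.mul_le_mul le_rfl (by omega)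
  rw [mul_add] at h3
  omega

theorem le_last (hF : IsFrame G v w g) {z : Mon} (hz : z ∈ G) : z v ≤ g (Fin.last m) v := by
  have h : g (Fin.last m) w ≤ z w := by simpa using hF.swap.zero_le hz
  by_contra! hc
  have := hF.lt_of_lt (hF.mem _) hz hc
  omega

theorem sumsOf_bounds (hF : IsFrame G v w g) {n : ℕ} {u : Mon} (hu : u ∈ sumsOf G n) :
    n * g 0 v ≤ u v ∧ u v ≤ n * g (Fin.last m) v := by
  obtain ⟨s, rfl, hs, rfl⟩ := hu
  exact multiset_sum_bounds s fun z hz => ⟨hF.zero_le (hs z hz), hF.le_last (hs z hz)⟩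

/-- Both sides have the same `v`-degree. If the right side were smaller in `w`, it would be a proper
divisor of `(a + b) • g p` in the power `a + b`, against weak persistence of `g p`. -/
theorem convex (hF : IsFrame G v w g) {i p j : Fin (m + 1)} (hip : i < p) {a b : ℕ}
    (ha : g p v = g i v + a) (hb : g j v = g p v + b) :
    (a + b) • g p ≤ b • g i + a • g j := by
  have h1 : g i v < g p v := hF.mono hip
  have hv : (a + b) * g p v = b * g i v + a * g j v := by
    rw [hb, ha]; ring
  by_contra hc
  have hw : b * g i w + a * g j w < (a + b) * g p w := by
    rw [mon_le_iff hF.ne] at hc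
    simp only [Finsupp.smul_apply, Finsupp.add_apply, smul_eq_mul] at hc
    omega
  have hmem : b • g i + a • g j ∈ powExp G (a + b) := by
    rw [add_comm a b]
    exact sumsOf_subset_powExp _ _
      (sumsOf_add (nsmul_mem_sumsOf (hF.mem i) b) (nsmul_mem_sumsOf (hF.mem j) a))
  have := (hF.weak p (a + b) (by omega)).2 _ hmem ((mon_le_iff hF.ne).2 ⟨by
    simpa using hv.ge, by simpa using hw.le⟩)
  have := congrArg (fun f : Mon => f w) this
  simp at this
  omega

/-- The elements of the frame lie on or above the line through two consecutive ones. -/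
theorem support_segment (hF : IsFrame G v w g) (i : Fin m) (p : Fin (m + 1)) {d e : ℕ}
    (hd : g i.succ v = g i.castSucc v + d) (he : g i.castSucc w = g i.succ w + e) :
    e * g i.castSucc v + d * g i.castSucc w ≤ e * g p v + d * g p w := by
  have hlt : i.castSucc < i.succ := Fin.castSucc_lt_succ
  rcases lt_trichotomy p i.castSucc with h | rfl | h
  · obtain ⟨a, ha⟩ := Nat.exists_eq_add_of_le (show g p v ≤ g i.castSucc v from (hF.mono h).le)
    have := ((mon_le_iff hF.ne).1 (hF.convex h ha hd)).2
    simp only [Finsupp.smul_apply, Finsupp.add_apply, smul_eq_mul] at this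
    nlinarith
  · exact le_rfl
  · rcases (show i.succ ≤ p from Fin.castSucc_lt_iff_succ_le.1 h).eq_or_lt with rfl | h'
    · rw [hd, he]; exact le_of_eq (by ring)
    · obtain ⟨a, ha⟩ := Nat.exists_eq_add_of_le (show g i.succ v ≤ g p v from (hF.mono h').le)
      have := ((mon_le_iff hF.ne).1 (hF.convex hlt hd ha)).2
      simp only [Finsupp.smul_apply, Finsupp.add_apply, smul_eq_mul] at this
      nlinarith

/-- The functional normal to the segment attains its minimum over `G` at a frame element, and no
frame element lies below the segment's line. Hence neither does `z`. -/
theorem segment_le (hF : IsFrame G v w g) (i : Fin m) {z : Mon} (hz : z ∈ G) {a b : ℕ}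
    (ha : z v = g i.castSucc v + a) (hb : g i.succ v = z v + b) (hab : 0 < a + b) :
    b • g i.castSucc + a • g i.succ ≤ (a + b) • z := by
  have hlt : i.castSucc < i.succ := Fin.castSucc_lt_succ
  obtain ⟨e, he⟩ := Nat.exists_eq_add_of_lt (hF.anti hlt)
  obtain ⟨p, hp⟩ := hF.support (e + 1) (a + b) (by omega) hab
  have h1 := hF.support_segment i p (d := a + b) (e := e + 1) (by omega) (by omega)
  have h2 := hp z hz
  rw [mon_le_iff hF.ne]
  simp only [Finsupp.smul_apply, Finsupp.add_apply, smul_eq_mul]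
  constructor
  · rw [hb, ha]; exact le_of_eq (by ring)
  · nlinarith

end IsFrame

/-! ### Exchange arguments and the decomposition of large powers. -/

theorem exists_step {m : ℕ} (f : Fin (m + 1) → ℕ) {x : ℕ} (h0 : f 0 ≤ x) (hx : x < f (Fin.last m)) :
    ∃ i : Fin m, f i.castSucc ≤ x ∧ x < f i.succ := by
  by_contra! hc
  have : ∀ i, f i ≤ x := fun i => Fin.induction h0 (fun j hj => hc j hj) i
  exact absurd (this (Fin.last m)) (by omega)

/-- Two indices with value above `d` cannot have another index between them, so at most two exist
and they are adjacent. The pair is chosen to start at the least such index, or to end at it if it is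
the last. -/
theorem exists_adjacent_of_small {m : ℕ} (hm : 0 < m) {d : ℕ} (c : Fin (m + 1) → ℕ)
    (h : ∀ i p j, i < p → p < j → c i ≤ d ∨ c j ≤ d) :
    ∃ i : Fin m, ∑ p, c p ≤ c i.castSucc + c i.succ + (m + 1) * d := by
  have key : ∃ i : Fin m, ∀ p, p ≠ i.castSucc → p ≠ i.succ → c p ≤ d := by
    by_cases hall : ∀ p, c p ≤ d
    · exact ⟨⟨0, hm⟩, fun p _ _ => hall p⟩
    · push Not at hall
      obtain ⟨p₀, hp₀, hmin⟩ := WellFounded.has_min (wellFounded_lt (α := Fin (m + 1)))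
        {p | d < c p} hall
      have hmin' : ∀ p, p < p₀ → c p ≤ d := fun p hp => by
        by_contra! hc
        exact hmin p hc hp
      rcases Fin.eq_castSucc_or_eq_last p₀ with ⟨i, rfl⟩ | rfl
      · refine ⟨i, fun p h1 h2 => ?_⟩
        rcases lt_or_gt_of_ne h1 with h3 | h3
        · exact hmin' p h3
        · have h4 : i.succ < p :=
            lt_of_le_of_ne (Fin.castSucc_lt_iff_succ_le.1 h3) h2.symm
          rcases h i.castSucc i.succ p Fin.castSucc_lt_succ h4 with h5 | h5
          · exact absurd h5 (not_le.2 hp₀)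
          · exact h5
      · refine ⟨⟨m - 1, by omega⟩, fun p _ h2 => hmin' p ?_⟩
        refine lt_of_le_of_ne (Fin.le_last p) fun h3 => h2 ?_
        rw [h3]
        ext
        simp
        omega
  obtain ⟨i, hi⟩ := key
  refine ⟨i, ?_⟩
  calc ∑ p, c p ≤ ∑ p, ((if p = i.castSucc then c p else 0) +
        (if p = i.succ then c p else 0) + d) := by
        refine Finset.sum_le_sum fun p _ => ?_
        have := hi p
        split_ifs <;> omega
    _ = c i.castSucc + c i.succ + (m + 1) * d := by
        simp [Finset.sum_add_distrib]

namespace IsFrame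

variable {G : Set Mon} {v w : Fin 2} {m : ℕ} {g : Fin (m + 1) → Mon}

theorem injective (hF : IsFrame G v w g) : Function.Injective g := fun _ _ h =>
  hF.mono.injective (congrArg (fun f : Mon => f v) h)

theorem eq_of_apply_eq (hF : IsFrame G v w g) {a b : Mon} (ha : a ∈ G) (hb : b ∈ G)
    (h : a v = b v) : a = b := by
  rcases le_total (a w) (b w) with h' | h'
  · exact hF.antichain a ha b hb ((mon_le_iff hF.ne).2 ⟨h.le, h'⟩)
  · exact (hF.antichain b hb a ha ((mon_le_iff hF.ne).2 ⟨h.ge, h'⟩)).symm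

theorem exists_between (hF : IsFrame G v w g) {z : Mon} (hz : z ∈ G) (hzg : z ∉ Set.range g) :
    ∃ i : Fin m, g i.castSucc v < z v ∧ z v < g i.succ v := by
  have hne : ∀ i, g i v ≠ z v := fun i h => hzg ⟨i, hF.eq_of_apply_eq (hF.mem i) hz h⟩
  obtain ⟨i, h1, h2⟩ := exists_step (fun i => g i v) (hF.zero_le hz)
    (lt_of_le_of_ne (hF.le_last hz) (hne _).symm)
  exact ⟨i, lt_of_le_of_ne h1 (hne _), h2⟩

theorem exists_replacement (hF : IsFrame G v w g) {δ : ℕ}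
    (hδ : ∀ i : Fin m, min (g i.succ v - g i.castSucc v) (g i.castSucc w - g i.succ w) ≤ δ + 1)
    {z : Mon} (hz : z ∈ G) (hzg : z ∉ Set.range g) :
    ∃ t : Multiset Mon, 0 < t.card ∧ t.card ≤ δ + 1 ∧ (∀ h ∈ t, h ∈ Set.range g) ∧
      t.sum ≤ t.card • z := by
  have main : ∃ (i j : Fin (m + 1)) (a b : ℕ), 0 < a + b ∧ a + b ≤ δ + 1 ∧
      b • g i + a • g j ≤ (a + b) • z := by
    obtain ⟨i, h1, h2⟩ := hF.exists_between hz hzg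
    have h3 := hF.lt_of_lt (hF.mem _) hz h1
    have h4 := hF.lt_of_lt hz (hF.mem _) h2
    -- The number of copies traded is the width of the segment in the shorter direction; the second
    -- direction is the first one for the reversed frame.
    rcases min_le_iff.1 (hδ i) with h | h
    · exact ⟨i.castSucc, i.succ, z v - g i.castSucc v, g i.succ v - z v, by omega, by omega,
        hF.segment_le i hz (by omega) (by omega) (by omega)⟩
    · refine ⟨i.succ, i.castSucc, z w - g i.succ w, g i.castSucc w - z w, by omega, by omega, ?_⟩
      have := hF.swap.segment_le i.rev hz (a := z w - g i.succ w) (b := g i.castSucc w - z w)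
      simp only [Function.comp_apply, Fin.rev_castSucc, Fin.rev_succ, Fin.rev_rev] at this
      exact this (by omega) (by omega) (by omega)
  obtain ⟨i, j, a, b, h0, h1, h2⟩ := main
  refine ⟨Multiset.replicate b (g i) + Multiset.replicate a (g j), ?_, ?_, ?_, ?_⟩
  · simp; omega
  · simp; omega
  · intro h hh
    rcases Multiset.mem_add.1 hh with hh | hh <;> rw [Multiset.eq_of_mem_replicate hh] <;> simp
  · simpa [add_comm b a] using h2

/-- Each trade turns copies of a non-frame generator into frame elements, so the number of non-frame
factors drops and the process ends. -/
theorem exists_reduced_nonframe {δ : ℕ} (hg : Set.range g ⊆ G)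
    (hr : ∀ z ∈ G, z ∉ Set.range g → ∃ t : Multiset Mon, 0 < t.card ∧ t.card ≤ δ + 1 ∧
      (∀ h ∈ t, h ∈ Set.range g) ∧ t.sum ≤ t.card • z)
    (s : Multiset Mon) (hs : ∀ h ∈ s, h ∈ G) :
    ∃ t : Multiset Mon, t.card = s.card ∧ (∀ h ∈ t, h ∈ G) ∧ t.sum ≤ s.sum ∧
      ∀ z, z ∉ Set.range g → t.count z ≤ δ := by
  classical
  induction hn : s.countP (· ∉ Set.range g) using Nat.strong_induction_on generalizing s with
  | _ k ih =>
    by_cases hall : ∀ z, z ∉ Set.range g → s.count z ≤ δ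
    · exact ⟨s, rfl, hs, le_rfl, hall⟩
    push Not at hall
    obtain ⟨z, hz, hcount⟩ := hall
    obtain ⟨t, ht0, htδ, htg, htz⟩ :=
      hr z (hs z (Multiset.count_pos.1 (by omega))) hz
    obtain ⟨s', rfl⟩ := Multiset.le_iff_exists_add.1
      (Multiset.le_count_iff_replicate_le.1 (show t.card ≤ s.count z by omega))
    have h1 : t.countP (· ∉ Set.range g) = 0 :=
      Multiset.countP_eq_zero.2 fun h hh => not_not.2 (htg h hh)
    have h2 : (Multiset.replicate t.card z).countP (· ∉ Set.range g) = t.card := by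
      rw [Multiset.countP_eq_card.2 fun h hh => by rwa [Multiset.eq_of_mem_replicate hh]]
      simp
    obtain ⟨u, hu1, hu2, hu3, hu4⟩ := ih ((t + s').countP (· ∉ Set.range g)) (by
      rw [Multiset.countP_add] at hn ⊢
      omega) (t + s') (fun h hh => by
        rcases Multiset.mem_add.1 hh with hh | hh
        exacts [hg (htg h hh), hs h (Multiset.mem_add.2 (Or.inr hh))]) rfl
    refine ⟨u, by simpa using hu1, hu2, hu3.trans ?_, hu4⟩
    simpa using htz

theorem exists_reduced_frame (hF : IsFrame G v w g) {d : ℕ}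
    (hd : ∀ i p j, i < p → p < j → g p v - g i v ≤ d + 1 ∧ g j v - g p v ≤ d + 1)
    (s : Multiset Mon) (hs : ∀ h ∈ s, h ∈ Set.range g) :
    ∃ t : Multiset Mon, t.card = s.card ∧ (∀ h ∈ t, h ∈ Set.range g) ∧ t.sum ≤ s.sum ∧
      ∀ i p j, i < p → p < j → t.count (g i) ≤ d ∨ t.count (g j) ≤ d := by
  classical
  induction hn : (s.map fun z => z v ^ 2).sum using Nat.strong_induction_on generalizing s with
  | _ k ih =>
    by_cases hall : ∀ i p j, i < p → p < j → s.count (g i) ≤ d ∨ s.count (g j) ≤ d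
    · exact ⟨s, rfl, hs, le_rfl, hall⟩
    push Not at hall
    obtain ⟨i, p, j, hip, hpj, hci, hcj⟩ := hall
    obtain ⟨hb1, hb2⟩ := hd i p j hip hpj
    have hlt1 : g i v < g p v := hF.mono hip
    have hlt2 : g p v < g j v := hF.mono hpj
    obtain ⟨a, ha⟩ := Nat.exists_eq_add_of_le hlt1.le
    obtain ⟨b, hb⟩ := Nat.exists_eq_add_of_le hlt2.le
    have hconv := hF.convex hip ha hb
    have hsub : Multiset.replicate b (g i) + Multiset.replicate a (g j) ≤ s := by
      have hij : g i ≠ g j := hF.injective.ne (hip.trans hpj).ne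
      rw [Multiset.le_iff_count]
      intro x
      rw [Multiset.count_add, Multiset.count_replicate, Multiset.count_replicate]
      split_ifs with h1 h2 h2
      · exact absurd (h1.trans h2.symm) hij
      · subst h1; omega
      · subst h2; omega
      · omega
    obtain ⟨s', rfl⟩ := Multiset.le_iff_exists_add.1 hsub
    -- Moving both ends to their weighted mean lowers the sum of squared `v`-degrees, by strict
    -- convexity; this makes the exchange terminate.
    have hpot : (a + b) * g p v ^ 2 < b * g i v ^ 2 + a * g j v ^ 2 := by
      have hab : 0 < a * b * (a + b) :=
        Nat.mul_pos (Nat.mul_pos (by omega) (by omega)) (by omega)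
      rw [hb, ha]
      nlinarith
    obtain ⟨u, hu1, hu2, hu3, hu4⟩ := ih
      (((Multiset.replicate (a + b) (g p) + s').map fun z => z v ^ 2).sum) (by
        simp at hn ⊢
        omega) (Multiset.replicate (a + b) (g p) + s') (fun h hh => by
        rcases Multiset.mem_add.1 hh with hh | hh
        · rw [Multiset.eq_of_mem_replicate hh]; simp
        · exact hs h (Multiset.mem_add.2 (Or.inr hh))) rfl
    refine ⟨u, by simpa [add_comm b a] using hu1, hu2, hu3.trans ?_, hu4⟩
    simpa using hconv

/-- Every monomial of the power `D + n` is divisible by the product of a monomial of the power `D`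
and `n` factors taken from two consecutive elements of the frame. -/
def Decomposes (G : Set Mon) (g : Fin (m + 1) → Mon) (D : ℕ) : Prop :=
  ∀ n, ∀ f ∈ powExp G (D + n), ∃ (i : Fin m) (a b : ℕ), a + b = n ∧
    ∃ u ∈ sumsOf G D, u + a • g i.castSucc + b • g i.succ ≤ f

theorem decomposes (hF : IsFrame G v w g) (hm : 0 < m) {δ d D : ℕ}
    (hδ : ∀ i : Fin m, min (g i.succ v - g i.castSucc v) (g i.castSucc w - g i.succ w) ≤ δ + 1)
    (hd : 2 ≤ m → min (g (Fin.last m) v - g 0 v) (g 0 w - g (Fin.last m) w) ≤ d + 2)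
    (hD : (G.ncard - (m + 1)) * δ + (m + 1) * d ≤ D) : Decomposes G g D := by
  classical
  rintro n f ⟨_, ⟨s, hs, hsG, rfl⟩, hle⟩
  have hgG : Set.range g ⊆ G := by
    rintro _ ⟨i, rfl⟩
    exact hF.mem i
  obtain ⟨t, ht1, ht2, ht3, ht4⟩ := exists_reduced_nonframe hgG
    (fun z hz hzg => hF.exists_replacement hδ hz hzg) s hsG
  have hframe : ∃ q : Multiset Mon, q.card = (t.filter (· ∈ Set.range g)).card ∧
      (∀ h ∈ q, h ∈ Set.range g) ∧ q.sum ≤ (t.filter (· ∈ Set.range g)).sum ∧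
      ∀ i p j, i < p → p < j → q.count (g i) ≤ d ∨ q.count (g j) ≤ d := by
    -- With three indices, a total width of at most `d + 2` leaves each of the two steps at most `d
    -- + 1`, since the other is at least 1. With fewer than three elements there is nothing to
    -- exchange.
    by_cases h2 : 2 ≤ m
    · have bound : ∀ {v w : Fin 2} {g : Fin (m + 1) → Mon}, IsFrame G v w g →
          g (Fin.last m) v - g 0 v ≤ d + 2 → ∀ i p j, i < p → p < j →
            g p v - g i v ≤ d + 1 ∧ g j v - g p v ≤ d + 1 := by
        intro v w g hF h i p j hip hpj
        have h1 : g i v < g p v := hF.mono hip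
        have h2 : g p v < g j v := hF.mono hpj
        have h3 : g 0 v ≤ g i v := hF.mono.monotone (Fin.zero_le i)
        have h4 : g j v ≤ g (Fin.last m) v := hF.mono.monotone (Fin.le_last j)
        omega
      rcases min_le_iff.1 (hd h2) with h | h
      · exact hF.exists_reduced_frame (bound hF h) _ fun h hh => (Multiset.mem_filter.1 hh).2
      · obtain ⟨q, hq1, hq2, hq3, hq4⟩ := hF.swap.exists_reduced_frame
          (bound hF.swap (by simpa using h)) (t.filter (· ∈ Set.range g)) fun h hh => by
            obtain ⟨i, hi⟩ := (Multiset.mem_filter.1 hh).2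
            exact ⟨i.rev, by simpa using hi⟩
        refine ⟨q, hq1, fun h hh => ?_, hq3, fun i p j hip hpj => ?_⟩
        · obtain ⟨i, hi⟩ := hq2 h hh
          exact ⟨i.rev, hi⟩
        · simpa using (hq4 j.rev p.rev i.rev (Fin.rev_lt_rev.2 hpj) (Fin.rev_lt_rev.2 hip)).symm
    · refine ⟨_, rfl, fun h hh => (Multiset.mem_filter.1 hh).2, le_rfl, fun i p j hip hpj => ?_⟩
      omega
  obtain ⟨q, hq1, hq2, hq3, hq4⟩ := hframe
  obtain ⟨i, hi⟩ := exists_adjacent_of_small hm (fun i => q.count (g i)) hq4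
  have hqcard : ∑ p, q.count (g p) = q.card := by
    rw [← Multiset.sum_count_eq_card (s := Finset.univ.image g) (m := q) fun h hh => by
      simpa using hq2 h hh, Finset.sum_image fun a _ b _ h => hF.injective h]
  have hcardG : ((hF.finite.toFinset) \ Finset.univ.image g).card = G.ncard - (m + 1) := by
    rw [Finset.card_sdiff_of_subset fun x hx => by
      obtain ⟨i, -, rfl⟩ := Finset.mem_image.1 hx
      simpa using hF.mem i, Finset.card_image_of_injective _ hF.injective,
      Set.ncard_eq_toFinset_card _ hF.finite]
    simp
  have hrest : (t.filter (· ∉ Set.range g)).card ≤ (G.ncard - (m + 1)) * δ := by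
    rw [← Multiset.sum_count_eq_card (s := hF.finite.toFinset \ Finset.univ.image g) fun h hh => by
      have := Multiset.mem_filter.1 hh
      simpa using ⟨ht2 h this.1, by simpa using this.2⟩, ← hcardG]
    refine Finset.sum_le_card_nsmul _ _ _ fun z hz => ?_
    refine (Multiset.count_le_of_le z (Multiset.filter_le _ _)).trans (ht4 z ?_)
    simpa using (Finset.mem_sdiff.1 hz).2
  have hsplit := congrArg Multiset.card (Multiset.filter_add_not (· ∈ Set.range g) t)
  have hsplit' := congrArg Multiset.sum (Multiset.filter_add_not (· ∈ Set.range g) t)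
  rw [Multiset.card_add] at hsplit
  rw [Multiset.sum_add] at hsplit'
  -- Of the `D + n` factors, at most `(G.ncard - (m + 1)) * δ` lie outside the frame and at most `(m
  -- + 1) * d` are frame elements off the chosen pair.
  have hn : n ≤ q.count (g i.castSucc) + q.count (g i.succ) := by omega
  obtain ⟨a, b, hab, ha, hb⟩ : ∃ a b, a + b = n ∧ a ≤ q.count (g i.castSucc) ∧
      b ≤ q.count (g i.succ) :=
    ⟨min n (q.count (g i.castSucc)), n - min n (q.count (g i.castSucc)), by omega, by omega,
      by omega⟩
  have hsub : Multiset.replicate a (g i.castSucc) + Multiset.replicate b (g i.succ) ≤ q := by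
    have hij : g i.castSucc ≠ g i.succ := hF.injective.ne (Fin.castSucc_lt_succ).ne
    rw [Multiset.le_iff_count]
    intro x
    rw [Multiset.count_add, Multiset.count_replicate, Multiset.count_replicate]
    split_ifs with h1 h2 h2
    · exact absurd (h1.trans h2.symm) hij
    · subst h1; omega
    · subst h2; omega
    · omega
  obtain ⟨q', rfl⟩ := Multiset.le_iff_exists_add.1 hsub
  refine ⟨i, a, b, hab, (q' + t.filter (· ∉ Set.range g)).sum, ⟨_, ?_, ?_, rfl⟩, ?_⟩
  · simp only [Multiset.card_add, Multiset.card_replicate] at hq1 ⊢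
    omega
  · intro h hh
    rcases Multiset.mem_add.1 hh with hh | hh
    · exact hgG (hq2 h (Multiset.mem_add.2 (Or.inr hh)))
    · exact ht2 h (Multiset.mem_filter.1 hh).1
  · refine le_trans ?_ (ht3.trans hle)
    rw [← hsplit']
    refine le_trans (le_of_eq ?_) (add_le_add hq3 le_rfl)
    simp only [Multiset.sum_add, Multiset.sum_replicate]
    abel

end IsFrame

/-! ### Counting generators by translation between consecutive powers. -/

/-- The number of minimal generators of the `n`-th power with `v`-degree at most `t`. -/
noncomputable def cnt (G : Set Mon) (v : Fin 2) (n t : ℕ) : ℕ :=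
  (minExp G n ∩ {f | f v ≤ t}).ncard

theorem cnt_eq_add {G : Set Mon} (hG : G.Finite) (v : Fin 2) (n : ℕ) {a b : ℕ} (hab : a ≤ b) :
    cnt G v n b = cnt G v n a + (minExp G n ∩ {f | a < f v ∧ f v ≤ b}).ncard := by
  have hfin := minExp_finite hG n
  rw [cnt, cnt, ← Set.ncard_union_eq _ (hfin.inter_of_left _) (hfin.inter_of_left _)]
  · congr 1
    ext f
    simp only [Set.mem_inter_iff, Set.mem_union, Set.mem_ofPred_eq]
    grind
  · rw [Set.disjoint_left]
    rintro f ⟨-, h1⟩ ⟨-, h2, -⟩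
    simp only [Set.mem_ofPred_eq] at h1
    omega

/-- Translation by `z` between two windows of consecutive powers preserves the count. -/
theorem cnt_shift {G : Set Mon} (hG : G.Finite) (v : Fin 2) {n a b a' b' : ℕ} {z : Mon}
    (hab : a ≤ b) (ha : a = a' + z v) (hb : b = b' + z v)
    (h1 : ∀ f ∈ minExp G (n + 1), a < f v → f v ≤ b → ∃ f' ∈ minExp G n, f' + z = f)
    (h2 : ∀ f ∈ minExp G n, a' < f v → f v ≤ b' → f + z ∈ minExp G (n + 1)) :
    cnt G v (n + 1) b + cnt G v n a' = cnt G v (n + 1) a + cnt G v n b' := by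
  have hab' : a' ≤ b' := by omega
  have key : (minExp G (n + 1) ∩ {f | a < f v ∧ f v ≤ b}) =
      (fun f => f + z) '' (minExp G n ∩ {f | a' < f v ∧ f v ≤ b'}) := by
    ext f
    constructor
    · rintro ⟨hf, hfa, hfb⟩
      obtain ⟨f', hf', rfl⟩ := h1 f hf hfa hfb
      rw [Finsupp.add_apply] at hfa hfb
      exact ⟨f', ⟨hf', by omega, by omega⟩, rfl⟩
    · rintro ⟨f', ⟨hf', hfa, hfb⟩, rfl⟩
      refine ⟨h2 f' hf' hfa hfb, ?_⟩
      simp only [Set.mem_ofPred_eq, Finsupp.add_apply]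
      omega
  rw [cnt_eq_add hG v (n + 1) hab, cnt_eq_add hG v n hab', key,
    Set.ncard_image_of_injective _ (add_left_injective z)]
  omega

namespace IsFrame

variable {G : Set Mon} {v w : Fin 2} {m : ℕ} {g : Fin (m + 1) → Mon}

/-- By minimality the decomposition of `f` is an equality, and the part from the power `D` has
`v`-degree between `D * g 0 v` and `D * g (Fin.last m) v`. The two degree conditions then exclude
every decomposition in which `g i` does not occur. -/
theorem sub_mem_minExp (hF : IsFrame G v w g) {D : ℕ} (hdec : Decomposes G g D) {k : ℕ} {f : Mon}
    (hf : f ∈ minExp G (D + k + 1)) (i : Fin (m + 1))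
    (h1 : ∀ p < i, (k + 1) * g p v + D * g (Fin.last m) v < f v)
    (h2 : ∀ p, i < p → f v < (k + 1) * g p v + D * g 0 v) :
    ∃ f' ∈ minExp G (D + k), f' + g i = f := by
  suffices h : ∃ f' ∈ powExp G (D + k), f' + g i = f by
    obtain ⟨f', hf', rfl⟩ := h
    exact ⟨f', minExp_of_add (hF.mem i) hf' hf, rfl⟩
  obtain ⟨j, a, b, hab, u, hu, hle⟩ := hdec (k + 1) f hf.1
  have hs : ∀ j c, c • g j ∈ sumsOf G c := fun j c => nsmul_mem_sumsOf (hF.mem j) c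
  have heq : u + a • g j.castSucc + b • g j.succ = f := hf.2 _ (by
    have := sumsOf_add (sumsOf_add hu (hs j.castSucc a)) (hs j.succ b)
    rw [show D + a + b = D + k + 1 by omega] at this
    exact sumsOf_subset_powExp _ _ this) hle
  have hfv : u v + a * g j.castSucc v + b * g j.succ v = f v := by
    simpa using congrArg (fun f : Mon => f v) heq
  have hbd := hF.sumsOf_bounds hu
  have hlt : g j.castSucc v < g j.succ v := hF.mono Fin.castSucc_lt_succ
  have hjj : j.castSucc < j.succ := Fin.castSucc_lt_succ
  rcases lt_trichotomy i j.castSucc with hij | rfl | hij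
  · have := h2 _ hij
    have := Nat.mul_le_mul_left b hlt.le
    rw [← hab, add_mul] at *
    omega
  · rcases Nat.eq_zero_or_pos a with rfl | ha
    · have := h2 _ hjj
      rw [show k + 1 = b by omega] at this
      omega
    · obtain ⟨a, rfl⟩ := Nat.exists_eq_add_of_lt ha
      refine ⟨u + a • g j.castSucc + b • g j.succ, ?_, ?_⟩
      · have := sumsOf_add (sumsOf_add hu (hs j.castSucc a)) (hs j.succ b)
        rw [show D + a + b = D + k by omega] at this
        exact sumsOf_subset_powExp _ _ this
      · rw [← heq, zero_add, succ_nsmul]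
        abel
  · rcases (Fin.castSucc_lt_iff_succ_le.1 hij).eq_or_lt with rfl | hij'
    · rcases Nat.eq_zero_or_pos b with rfl | hb
      · have := h1 _ hjj
        rw [show k + 1 = a by omega] at this
        omega
      · obtain ⟨b, rfl⟩ := Nat.exists_eq_add_of_lt hb
        refine ⟨u + a • g j.castSucc + b • g j.succ, ?_, ?_⟩
        · have := sumsOf_add (sumsOf_add hu (hs j.castSucc a)) (hs j.succ b)
          rw [show D + a + b = D + k by omega] at this
          exact sumsOf_subset_powExp _ _ this
        · rw [← heq, zero_add, succ_nsmul]
          abel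
    · have := h1 _ hij'
      have := Nat.mul_le_mul_left a hlt.le
      rw [← hab, add_mul] at *
      omega

theorem nsmul_le_of_lt (hF : IsFrame G v w g) {n : ℕ} (hn : 0 < n) {f : Mon} (hf : f ∈ minExp G n)
    (i : Fin (m + 1)) (h : f v < n * g i v) : n * g i w < f w := by
  simpa using minExp_lt hF.ne hf (hF.weak i n hn) (by simpa using h)

theorem le_nsmul_of_le (hF : IsFrame G v w g) {n : ℕ} (hn : 0 < n) {f : Mon} (hf : f ∈ minExp G n)
    (i : Fin (m + 1)) (h : n * g i v ≤ f v) : f w ≤ n * g i w := by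
  simpa using minExp_le hF.ne (hF.weak i n hn) hf (by simpa using h)

theorem lt_nsmul_of_lt (hF : IsFrame G v w g) {n : ℕ} (hn : 0 < n) {f : Mon} (hf : f ∈ minExp G n)
    (i : Fin (m + 1)) (h : n * g i v < f v) : f w < n * g i w := by
  simpa using minExp_lt hF.ne (hF.weak i n hn) hf (by simpa using h)

/-- This is what `r` is for: more than `r` copies of distinct frame elements are further apart than
the uncertainty coming from the power `D`. -/
theorem gap (hF : IsFrame G v w g) {D r : ℕ}
    (hr : ∀ i : Fin m, D * (g (Fin.last m) v - g 0 v) ≤ r * (g i.succ v - g i.castSucc v))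
    {p q : Fin (m + 1)} (hpq : p < q) {k : ℕ} (hk : r < k) :
    k * g p v + D * g (Fin.last m) v < k * g q v + D * g 0 v := by
  obtain ⟨i, rfl⟩ : ∃ i : Fin m, i.castSucc = p :=
    Fin.exists_castSucc_eq.2 (ne_of_lt (lt_of_lt_of_le hpq (Fin.le_last q)))
  have h1 : g i.castSucc v < g i.succ v := hF.mono Fin.castSucc_lt_succ
  have h2 : g i.succ v ≤ g q v := hF.mono.monotone (Fin.castSucc_lt_iff_succ_le.1 hpq)
  have h3 : g 0 v ≤ g (Fin.last m) v := hF.mono.monotone (Fin.zero_le _)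
  have h4 := hr i
  obtain ⟨c, hc⟩ := Nat.exists_eq_add_of_le h3
  obtain ⟨e, he⟩ := Nat.exists_eq_add_of_lt h1
  obtain ⟨e', he'⟩ := Nat.exists_eq_add_of_le h2
  obtain ⟨k', rfl⟩ := Nat.exists_eq_add_of_lt hk
  rw [hc, he, show g 0 v + c - g 0 v = c by omega,
    show g i.castSucc v + e + 1 - g i.castSucc v = e + 1 by omega] at h4
  rw [he', hc, he]
  nlinarith [Nat.zero_le (k' * e), Nat.zero_le (k' * e'), Nat.zero_le (r * e')]

/-- Left translation: below the cut the generators of consecutive powers differ by `g i`. -/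
theorem add_left_mem (hF : IsFrame G v w g) {D r : ℕ} (hdec : Decomposes G g D)
    (hr : ∀ i : Fin m, D * (g (Fin.last m) v - g 0 v) ≤ r * (g i.succ v - g i.castSucc v))
    {k T : ℕ} (hk : r < k) (i : Fin m) (hT : T < (k + 1) * g i.succ v + D * g 0 v) :
    (∀ f ∈ minExp G (D + k + 1), (D + k + 1) * g i.castSucc v ≤ f v → f v ≤ T →
      ∃ f' ∈ minExp G (D + k), f' + g i.castSucc = f) ∧
    (∀ f ∈ minExp G (D + k), (D + k) * g i.castSucc v ≤ f v → f v + g i.castSucc v ≤ T →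
      f + g i.castSucc ∈ minExp G (D + k + 1)) := by
  have H : ∀ f ∈ minExp G (D + k + 1), (D + k + 1) * g i.castSucc v ≤ f v → f v ≤ T →
      ∃ f' ∈ minExp G (D + k), f' + g i.castSucc = f := by
    intro f hf h1 h2
    refine hF.sub_mem_minExp hdec hf _ (fun p hp => ?_) fun p hp => ?_
    · refine lt_of_lt_of_le (hF.gap hr hp (by omega)) (le_trans ?_ h1)
      have : D * g 0 v ≤ D * g i.castSucc v :=
        Nat.mul_le_mul le_rfl (hF.mono.monotone (Fin.zero_le _))
      linarith
    · refine (h2.trans_lt hT).trans_le ?_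
      have : g i.succ v ≤ g p v := hF.mono.monotone (Fin.castSucc_lt_iff_succ_le.1 hp)
      gcongr
  refine ⟨H, fun f hf h1 h2 => ?_⟩
  have hmem : f + g i.castSucc ∈ powExp G (D + k + 1) :=
    powExp_add hf.1 (sumsOf_subset_powExp _ _ (mem_sumsOf_one (hF.mem _)))
  obtain ⟨c, hc, hcf⟩ := exists_minExp_le hmem
  have hcf' := (mon_le_iff hF.ne).1 hcf
  rw [Finsupp.add_apply, Finsupp.add_apply] at hcf'
  by_cases hcv : (D + k + 1) * g i.castSucc v ≤ c v
  · obtain ⟨c', hc', rfl⟩ := H c hc hcv (by omega)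
    rwa [← hf.2 c' hc'.1 (le_of_add_le_add_right hcf)]
  -- A divisor `c` left of the multiple of `g i` would have larger `w`-degree than that multiple,
  -- while `f + g i` does not.
  · have h3 := hF.nsmul_le_of_lt (by omega) hc i.castSucc (not_le.1 hcv)
    have h4 := hF.le_nsmul_of_le (by omega) hf i.castSucc h1
    rw [add_mul, one_mul] at h3
    omega

/-- Right translation: above the cut the generators of consecutive powers differ by the
next element of the frame. -/
theorem add_right_mem (hF : IsFrame G v w g) {D r : ℕ} (hdec : Decomposes G g D)
    (hr : ∀ i : Fin m, D * (g (Fin.last m) v - g 0 v) ≤ r * (g i.succ v - g i.castSucc v))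
    {k B : ℕ} (hk : r < k) (i : Fin m) (hB : k * g i.castSucc v + D * g (Fin.last m) v ≤ B) :
    (∀ f ∈ minExp G (D + k + 1), B + g i.castSucc v < f v → f v ≤ (D + k + 1) * g i.succ v →
      ∃ f' ∈ minExp G (D + k), f' + g i.succ = f) ∧
    (∀ f ∈ minExp G (D + k), B < f v → f v ≤ (D + k) * g i.succ v →
      f + g i.succ ∈ minExp G (D + k + 1)) := by
  have hlt : g i.castSucc v < g i.succ v := hF.mono Fin.castSucc_lt_succ
  have H : ∀ f ∈ minExp G (D + k + 1),
      (k + 1) * g i.castSucc v + D * g (Fin.last m) v < f v → f v ≤ (D + k + 1) * g i.succ v →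
      ∃ f' ∈ minExp G (D + k), f' + g i.succ = f := by
    intro f hf h1 h2
    refine hF.sub_mem_minExp hdec hf _ (fun p hp => ?_) fun p hp => ?_
    · refine lt_of_le_of_lt ?_ h1
      have : g p v ≤ g i.castSucc v := hF.mono.monotone (Fin.le_castSucc_iff.2 hp)
      gcongr
    · refine lt_of_le_of_lt (h2.trans ?_) (hF.gap hr hp (by omega))
      have : D * g i.succ v ≤ D * g (Fin.last m) v :=
        Nat.mul_le_mul le_rfl (hF.mono.monotone (Fin.le_last _))
      linarith
  refine ⟨fun f hf h1 h2 => H f hf (by rw [add_mul, one_mul]; omega) h2, fun f hf h1 h2 => ?_⟩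
  have hmem : f + g i.succ ∈ powExp G (D + k + 1) :=
    powExp_add hf.1 (sumsOf_subset_powExp _ _ (mem_sumsOf_one (hF.mem _)))
  obtain ⟨c, hc, hcf⟩ := exists_minExp_le hmem
  have hcf' := (mon_le_iff hF.ne).1 hcf
  rw [Finsupp.add_apply, Finsupp.add_apply] at hcf'
  by_cases hcv : (k + 1) * g i.castSucc v + D * g (Fin.last m) v < c v
  · obtain ⟨c', hc', rfl⟩ := H c hc hcv (by rw [add_mul (D + k), one_mul]; omega)
    rwa [← hf.2 c' hc'.1 (le_of_add_le_add_right hcf)]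
  exfalso
  have hw : g i.succ w < g i.castSucc w := hF.anti Fin.castSucc_lt_succ
  have hiD : D * g i.castSucc v ≤ D * g (Fin.last m) v :=
    Nat.mul_le_mul le_rfl (hF.mono.monotone (Fin.le_last _))
  -- If `c` lies over the segment but left of the cut, it contains `g i`, and removing it leaves a
  -- proper divisor of `f`. If `c` lies left of the segment, its `w`-degree is too large.
  by_cases hcv' : (D + k + 1) * g i.castSucc v ≤ c v
  · have hgap := hF.gap hr (Fin.castSucc_lt_succ (i := i)) (show r < k + 1 by omega)
    obtain ⟨c', hc', rfl⟩ := (hF.add_left_mem hdec hr hk i hgap).1 c hc hcv' (not_lt.1 hcv)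
    simp only [Finsupp.add_apply] at hcf' hcv
    rw [add_mul, one_mul] at hcv
    have := hf.2 c' hc'.1 ((mon_le_iff hF.ne).2 ⟨by omega, by omega⟩)
    subst this
    omega
  · have h3 := hF.nsmul_le_of_lt (by omega) hc i.castSucc (not_le.1 hcv')
    have h4 := hF.lt_nsmul_of_lt (by omega) hf i.castSucc (by
      rw [add_mul]; omega)
    rw [add_mul, one_mul] at h3
    omega

theorem cnt_zero (hF : IsFrame G v w g) {n : ℕ} (hn : 0 < n) : cnt G v n (n * g 0 v) = 1 := by
  rw [cnt, Set.ncard_eq_one]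
  refine ⟨n • g 0, Set.eq_singleton_iff_unique_mem.2 ⟨⟨hF.weak 0 n hn, by simp⟩, ?_⟩⟩
  rintro f ⟨hf, hfv⟩
  have h1 := (hF.sumsOf_bounds (minExp_subset_sumsOf _ _ hf)).1
  have h2 := hF.le_nsmul_of_le hn hf 0 h1
  refine ((hF.weak 0 n hn).2 f hf.1 ((mon_le_iff hF.ne).2 ⟨?_, ?_⟩))
  · simpa using hfv
  · simpa using h2

theorem cnt_last (hF : IsFrame G v w g) (n : ℕ) :
    cnt G v n (n * g (Fin.last m) v) = (minExp G n).ncard := by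
  rw [cnt, Set.inter_eq_left.2 fun f hf => ?_]
  exact (hF.sumsOf_bounds (minExp_subset_sumsOf _ _ hf)).2

/-- Passing to the next power adds one period to the generators over a segment. -/
theorem cnt_segment (hF : IsFrame G v w g) {D r : ℕ} (hdec : Decomposes G g D)
    (hr : ∀ i : Fin m, D * (g (Fin.last m) v - g 0 v) ≤ r * (g i.succ v - g i.castSucc v))
    {k B : ℕ} (hk : r < k) (i : Fin m) (hB : k * g i.castSucc v + D * g (Fin.last m) v ≤ B)
    (hB' : B < k * g i.succ v + D * g 0 v) :
    (cnt G v (D + k + 1) ((D + k + 1) * g i.succ v) : ℤ) -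
        cnt G v (D + k + 1) ((D + k + 1) * g i.castSucc v) =
      cnt G v (D + k) ((D + k) * g i.succ v) - cnt G v (D + k) ((D + k) * g i.castSucc v) +
        (cnt G v (D + k) (B + g i.succ v - g i.castSucc v) - cnt G v (D + k) B) := by
  have hlt : g i.castSucc v < g i.succ v := hF.mono Fin.castSucc_lt_succ
  have hiD : D * g i.castSucc v ≤ D * g (Fin.last m) v :=
    Nat.mul_le_mul le_rfl (hF.mono.monotone (Fin.le_last _))
  have hiD' : D * g 0 v ≤ D * g i.succ v :=
    Nat.mul_le_mul le_rfl (hF.mono.monotone (Fin.zero_le _))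
  obtain ⟨hl1, hl2⟩ := hF.add_left_mem hdec hr hk i (T := B + g i.succ v) (by
    rw [add_mul, one_mul]; omega)
  obtain ⟨hr1, hr2⟩ := hF.add_right_mem hdec hr hk i hB
  have e1 : (D + k) * g i.castSucc v = D * g i.castSucc v + k * g i.castSucc v := add_mul ..
  have e2 : (D + k) * g i.succ v = D * g i.succ v + k * g i.succ v := add_mul ..
  have e3 : (D + k + 1) * g i.castSucc v = (D + k) * g i.castSucc v + g i.castSucc v := by
    rw [add_mul, one_mul]
  have e4 : (D + k + 1) * g i.succ v = (D + k) * g i.succ v + g i.succ v := by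
    rw [add_mul, one_mul]
  -- The left shift uses the lower power up to `B + g i.succ v - g i.castSucc v`, the right shift
  -- uses it from `B` on; the overlap is counted twice and is the increment.
  have s1 := cnt_shift hF.finite v (n := D + k) (z := g i.castSucc)
    (a := (D + k + 1) * g i.castSucc v) (b := B + g i.succ v) (a' := (D + k) * g i.castSucc v)
    (b' := B + g i.succ v - g i.castSucc v) (by omega) e3 (by omega)
    (fun f hf h1 h2 => hl1 f hf h1.le h2) (fun f hf h1 h2 => hl2 f hf h1.le (by omega))
  have s2 := cnt_shift hF.finite v (n := D + k) (z := g i.succ)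
    (a := B + g i.succ v) (b := (D + k + 1) * g i.succ v) (a' := B)
    (b' := (D + k) * g i.succ v) (by omega) rfl e4
    (fun f hf h1 h2 => hr1 f hf (by omega) h2) hr2
  omega

/-- One whole window right of the cut still lies in the range of the left translation, so it
reappears at the cut `B + g i.castSucc v` of the next power. -/
theorem cnt_period (hF : IsFrame G v w g) {D r : ℕ} (hdec : Decomposes G g D)
    (hr : ∀ i : Fin m, D * (g (Fin.last m) v - g 0 v) ≤ r * (g i.succ v - g i.castSucc v))
    {k B : ℕ} (hk : r < k) (i : Fin m) (hB : k * g i.castSucc v + D * g (Fin.last m) v ≤ B)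
    (hB' : B < k * g i.succ v + D * g 0 v) :
    cnt G v (D + k + 1) (B + g i.succ v) + cnt G v (D + k) B =
      cnt G v (D + k + 1) (B + g i.castSucc v) +
        cnt G v (D + k) (B + g i.succ v - g i.castSucc v) := by
  have hlt : g i.castSucc v < g i.succ v := hF.mono Fin.castSucc_lt_succ
  have hiD : D * g i.castSucc v ≤ D * g (Fin.last m) v :=
    Nat.mul_le_mul le_rfl (hF.mono.monotone (Fin.le_last _))
  have e1 : (D + k) * g i.castSucc v = D * g i.castSucc v + k * g i.castSucc v := add_mul ..
  have e3 : (D + k + 1) * g i.castSucc v = (D + k) * g i.castSucc v + g i.castSucc v := by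
    rw [add_mul, one_mul]
  obtain ⟨hl1, hl2⟩ := hF.add_left_mem hdec hr hk i (T := B + g i.succ v) (by
    rw [add_mul, one_mul]; omega)
  exact cnt_shift hF.finite v (z := g i.castSucc) (by omega) rfl (by omega)
    (fun f hf h1 h2 => hl1 f hf (by omega) h2) (fun f hf h1 h2 => hl2 f hf (by omega) (by omega))

/-- Counts up to the multiples of `g i` are compared segment by segment. Moving the cut by `g
i.castSucc` from one power to the next makes both increments equal. -/
theorem ncard_second_difference (hF : IsFrame G v w g) {D r : ℕ} (hdec : Decomposes G g D)
    (hr : ∀ i : Fin m, D * (g (Fin.last m) v - g 0 v) ≤ r * (g i.succ v - g i.castSucc v))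
    {s : ℕ} (hs : D + r + 1 ≤ s) :
    (minExp G (s + 2)).ncard + (minExp G s).ncard = 2 * (minExp G (s + 1)).ncard := by
  obtain ⟨k, rfl⟩ := Nat.exists_eq_add_of_le (show D ≤ s by omega)
  have hk : r < k := by omega
  suffices h : ∀ i : Fin (m + 1), cnt G v (D + k + 1 + 1) ((D + k + 1 + 1) * g i v) +
      cnt G v (D + k) ((D + k) * g i v) = 2 * cnt G v (D + k + 1) ((D + k + 1) * g i v) by
    have := h (Fin.last m)
    rwa [hF.cnt_last, hF.cnt_last, hF.cnt_last] at this
  intro i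
  induction i using Fin.induction with
  | zero =>
    rw [hF.cnt_zero (by omega), hF.cnt_zero (by omega), hF.cnt_zero (by omega)]
  | succ i ih =>
    have hgap := hF.gap hr (Fin.castSucc_lt_succ (i := i)) hk
    have hlt : g i.castSucc v < g i.succ v := hF.mono Fin.castSucc_lt_succ
    have h1 := hF.cnt_segment hdec hr hk i le_rfl hgap
    have h2 := hF.cnt_segment hdec hr (k := k + 1)
      (B := k * g i.castSucc v + D * g (Fin.last m) v + g i.castSucc v) (by omega) i
      (by rw [add_mul, one_mul]; omega) (by rw [add_mul, one_mul]; omega)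
    have h3 := hF.cnt_period hdec hr hk i le_rfl hgap
    rw [show k * g i.castSucc v + D * g (Fin.last m) v + g i.castSucc v + g i.succ v -
      g i.castSucc v = k * g i.castSucc v + D * g (Fin.last m) v + g i.succ v by omega,
      ← add_assoc D k 1] at h2
    omega

end IsFrame

theorem linear_of_second_difference (f : ℕ → ℕ) {s : ℕ}
    (h : ∀ t, s ≤ t → f (t + 2) + f t = 2 * f (t + 1)) (l : ℕ) :
    (f (s + l) : ℤ) = f s + l * ((f (s + 1) : ℤ) - f s) := by
  induction l using Nat.strong_induction_on with
  | _ l ih =>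
    match l with
    | 0 => simp
    | 1 => simp
    | l + 2 =>
      have h1 := ih l (by omega)
      have h2 := ih (l + 1) (by omega)
      have h3 := h (s + l) (by omega)
      rw [add_assoc s l 2, add_assoc s l 1] at h3
      zify at h3
      push_cast at *
      linarith

/-! ### Translation between monomial ideals and exponent vectors; distances. -/

variable {K : Type*} [Field K]

theorem mon_add (a b : Mon) : mon K (a + b) = mon K a * mon K b := by
  simp [mon, monomial_mul]

theorem mon_mem_span {S : Set Mon} {a : Mon} :
    mon K a ∈ Ideal.span (mon K '' S) ↔ ∃ b ∈ S, b ≤ a := by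
  classical
  have := mem_ideal_span_monomial_image (R := K) (x := mon K a) (s := S)
  rw [show mon K '' S = (fun s => monomial s (1 : K)) '' S from rfl, this]
  simp [mon, support_monomial]

theorem span_pow_eq (S : Set Mon) (n : ℕ) :
    Ideal.span (mon K '' S) ^ n = Ideal.span (mon K '' sumsOf S n) := by
  induction n with
  | zero =>
    rw [pow_zero, Ideal.one_eq_top, eq_comm, Ideal.eq_top_iff_one]
    have : (1 : MvPolynomial (Fin 2) K) = mon K 0 := rfl
    rw [this]
    exact Ideal.subset_span ⟨0, ⟨0, by simp, by simp, by simp⟩, rfl⟩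
  | succ n ih =>
    rw [pow_succ, ih, Ideal.span_mul_span']
    congr 1
    ext x
    rw [Set.mem_mul]
    constructor
    · rintro ⟨_, ⟨a, ha, rfl⟩, _, ⟨b, hb, rfl⟩, rfl⟩
      exact ⟨a + b, sumsOf_add ha (mem_sumsOf_one hb), mon_add a b⟩
    · rintro ⟨_, ⟨s, hs, hsS, rfl⟩, rfl⟩
      obtain ⟨z, hz⟩ := Multiset.card_pos_iff_exists_mem.1 (show 0 < s.card by omega)
      obtain ⟨t, rfl⟩ := Multiset.exists_cons_of_mem hz
      refine ⟨mon K t.sum, ⟨t.sum, ⟨t, by simpa using hs, fun h hh => hsS h (by simp [hh]), rfl⟩,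
        rfl⟩, mon K z, ⟨z, hsS z hz, rfl⟩, ?_⟩
      rw [← mon_add, Multiset.sum_cons, add_comm]

theorem mon_mem_span_pow {S : Set Mon} {n : ℕ} {a : Mon} :
    mon K a ∈ Ideal.span (mon K '' S) ^ n ↔ a ∈ powExp S n := by
  rw [span_pow_eq, mon_mem_span]
  rfl

theorem exists_minGens_le {I : Ideal (MvPolynomial (Fin 2) K)} {a : Mon} (ha : mon K a ∈ I) :
    ∃ b ∈ minGens I, b ≤ a := by
  obtain ⟨b, hba, hb⟩ := exists_minimal_le_of_wellFoundedLT (fun b => mon K b ∈ I) a ha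
  exact ⟨b, ⟨hb.prop, fun c hc hcb => le_antisymm hcb (hb.le_of_le hc hcb)⟩, hba⟩

theorem IsMonomialIdeal.eq_span_minGens {I : Ideal (MvPolynomial (Fin 2) K)}
    (hI : IsMonomialIdeal I) : I = Ideal.span (mon K '' minGens I) := by
  obtain ⟨S, hS⟩ := hI
  apply le_antisymm
  · conv_lhs => rw [hS]
    rw [Ideal.span_le]
    rintro _ ⟨a, ha, rfl⟩
    exact mon_mem_span.2 (exists_minGens_le (hS ▸ Ideal.subset_span ⟨a, ha, rfl⟩))
  · rw [Ideal.span_le]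
    rintro _ ⟨a, ha, rfl⟩
    exact ha.1

theorem IsMonomialIdeal.mon_mem_pow {I : Ideal (MvPolynomial (Fin 2) K)}
    (hI : IsMonomialIdeal I) {n : ℕ} {a : Mon} :
    mon K a ∈ I ^ n ↔ a ∈ powExp (minGens I) n := by
  conv_lhs => rw [hI.eq_span_minGens]
  exact mon_mem_span_pow

theorem IsMonomialIdeal.minGens_pow {I : Ideal (MvPolynomial (Fin 2) K)}
    (hI : IsMonomialIdeal I) (n : ℕ) : minGens (I ^ n) = minExp (minGens I) n := by
  ext a
  simp only [minGens, minExp, Set.mem_ofPred_eq, hI.mon_mem_pow]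

theorem minGens_antichain (I : Ideal (MvPolynomial (Fin 2) K)) :
    ∀ a ∈ minGens I, ∀ b ∈ minGens I, a ≤ b → a = b :=
  fun _ ha _ hb hab => hb.2 _ ha.1 hab

theorem minGens_finite (I : Ideal (MvPolynomial (Fin 2) K)) : (minGens I).Finite := by
  have h : IsAntichain (· ≤ ·) (minGens I) := fun a ha b hb hne hab =>
    hne (minGens_antichain I a ha b hb hab)
  exact WellQuasiOrderedLE.finite_of_isAntichain h

/-- Subtracting the gcd exponent, which is `lo` in direction `v`, carries the minimal generators of
`I` bijectively to those of the anchored ideal. -/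
theorem dist_eq {I : Ideal (MvPolynomial (Fin 2) K)} {v : Fin 2} {lo hi : ℕ}
    (hlo : ∃ z ∈ minGens I, z v = lo) (hlo' : ∀ z ∈ minGens I, lo ≤ z v)
    (hhi : ∃ z ∈ minGens I, z v = hi) (hhi' : ∀ z ∈ minGens I, z v ≤ hi) :
    dist v I = hi - lo := by
  have hgcd : gcdExp I v = lo := by
    refine IsLeast.csInf_eq ⟨?_, ?_⟩
    · obtain ⟨z, hz, h⟩ := hlo
      exact ⟨z, hz.1, h⟩
    · rintro _ ⟨a, ha, rfl⟩
      obtain ⟨b, hb, hba⟩ := exists_minGens_le ha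
      exact (hlo' b hb).trans (hba v)
  have hle : ∀ a, mon K a ∈ I → gcdExp I ≤ a := fun a ha u => Nat.sInf_le ⟨a, ha, rfl⟩
  have hanchor : ∀ b, mon K b ∈ anchor I ↔ mon K (b + gcdExp I) ∈ I := fun b => by
    rw [anchor, Submodule.mem_colon_singleton, mon_add, smul_eq_mul]
  have h1 : ∀ z ∈ minGens I, z - gcdExp I ∈ minGens (anchor I) := by
    intro z hz
    have hz' := tsub_add_cancel_of_le (hle z hz.1)
    refine ⟨by rw [hanchor, hz']; exact hz.1, fun b hb hbz => ?_⟩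
    rw [hanchor] at hb
    have := hz.2 _ hb (by rw [← hz']; exact add_le_add hbz le_rfl)
    rw [← this, add_tsub_cancel_right]
  have h2 : ∀ b ∈ minGens (anchor I), b + gcdExp I ∈ minGens I := by
    intro b hb
    obtain ⟨z, hz, hzb⟩ := exists_minGens_le ((hanchor b).1 hb.1)
    have hz' := tsub_add_cancel_of_le (hle z hz.1)
    rw [← hb.2 (z - gcdExp I) (h1 z hz).1 (tsub_le_iff_right.2 hzb), hz']
    exact hz
  refine IsGreatest.csSup_eq ⟨?_, ?_⟩
  · obtain ⟨z, hz, h⟩ := hhi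
    refine ⟨_, h1 z hz, ?_⟩
    simp [hgcd, h]
  · rintro _ ⟨b, hb, rfl⟩
    have := hhi' _ (h2 b hb)
    rw [Finsupp.add_apply, hgcd] at this
    exact Nat.le_sub_of_add_le this

theorem minGens_pair {a b : Mon} (hab : ¬a ≤ b) (hba : ¬b ≤ a) :
    minGens (Ideal.span {mon K a, mon K b}) = {a, b} := by
  have hmem : ∀ c, mon K c ∈ Ideal.span {mon K a, mon K b} ↔ a ≤ c ∨ b ≤ c := fun c => by
    rw [← Set.image_pair, mon_mem_span]
    simp
  ext c
  simp only [minGens, Set.mem_ofPred_eq, hmem, Set.mem_insert_iff, Set.mem_singleton_iff]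
  constructor
  · rintro ⟨h | h, hc⟩
    · exact Or.inl (hc a (Or.inl le_rfl) h).symm
    · exact Or.inr (hc b (Or.inr le_rfl) h).symm
  · rintro (rfl | rfl)
    · exact ⟨Or.inl le_rfl, fun d hd hdc => hd.elim (fun h => le_antisymm hdc h)
        fun h => absurd (h.trans hdc) hba⟩
    · exact ⟨Or.inr le_rfl, fun d hd hdc => hd.elim (fun h => absurd (h.trans hdc) hab)
        fun h => le_antisymm hdc h⟩

theorem pairDist_eq {v : Fin 2} {a b : Mon} (hab : ¬a ≤ b) (hba : ¬b ≤ a) (h : a v ≤ b v) :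
    pairDist K v a b = b v - a v := by
  refine dist_eq ?_ ?_ ?_ ?_ <;> simp [minGens_pair hab hba, h]

theorem pairDist_eq' {v : Fin 2} {a b : Mon} (hab : ¬a ≤ b) (hba : ¬b ≤ a) (h : b v ≤ a v) :
    pairDist K v a b = a v - b v := by
  refine dist_eq ?_ ?_ ?_ ?_ <;> simp [minGens_pair hab hba, h]

namespace IsFrame

variable {I : Ideal (MvPolynomial (Fin 2) K)} {v w : Fin 2} {m : ℕ} {g : Fin (m + 1) → Mon}

theorem dist_left (hF : IsFrame (minGens I) v w g) : dist v I = g (Fin.last m) v - g 0 v :=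
  dist_eq ⟨_, hF.mem 0, rfl⟩ (fun _ hz => hF.zero_le hz) ⟨_, hF.mem (Fin.last m), rfl⟩
    fun _ hz => hF.le_last hz

theorem dist_right (hF : IsFrame (minGens I) v w g) : dist w I = g 0 w - g (Fin.last m) w := by
  simpa using hF.swap.dist_left

theorem not_le (hF : IsFrame (minGens I) v w g) {i j : Fin (m + 1)} (hij : i ≠ j) :
    ¬g i ≤ g j := fun h =>
  hij (hF.injective (hF.antichain _ (hF.mem i) _ (hF.mem j) h))

theorem pairDist_left (hF : IsFrame (minGens I) v w g) (i : Fin m) :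
    pairDist K v (g i.castSucc) (g i.succ) = g i.succ v - g i.castSucc v :=
  have h : i.castSucc < i.succ := Fin.castSucc_lt_succ
  pairDist_eq (hF.not_le h.ne) (hF.not_le h.ne') (hF.mono h).le

theorem pairDist_right (hF : IsFrame (minGens I) v w g) (i : Fin m) :
    pairDist K w (g i.castSucc) (g i.succ) = g i.castSucc w - g i.succ w :=
  have h : i.castSucc < i.succ := Fin.castSucc_lt_succ
  pairDist_eq' (hF.not_le h.ne) (hF.not_le h.ne') (hF.anti h).le

end IsFrame

/-! ### Frames from persistent and weakly persistent generators. -/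

theorem multiset_sum_functional {v w : Fin 2} {p q L x : ℕ} (s : Multiset Mon)
    (h : ∀ z ∈ s, L < p * z v + q * z w ∨ (L = p * z v + q * z w ∧ x < z v)) (hs : s ≠ 0) :
    s.card * L < p * s.sum v + q * s.sum w ∨
      (s.card * L = p * s.sum v + q * s.sum w ∧ s.card * x < s.sum v) := by
  induction s using Multiset.induction_on with
  | empty => exact absurd rfl hs
  | cons a s ih =>
    have h2 := h a (by simp)
    by_cases hs' : s = 0
    · subst hs'
      simpa using h2
    have h1 := ih (fun z hz => h z (by simp [hz])) hs'
    simp only [Multiset.card_cons, Multiset.sum_cons, Finsupp.add_apply, add_mul, one_mul, mul_add]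
    omega

theorem le_multiset_sum_functional {v w : Fin 2} {p q L : ℕ} (s : Multiset Mon)
    (h : ∀ z ∈ s, L ≤ p * z v + q * z w) : s.card * L ≤ p * s.sum v + q * s.sum w := by
  induction s using Multiset.induction_on with
  | empty => simp
  | cons a s ih =>
    have h2 := h a (by simp)
    have h1 := ih (fun z hz => h z (by simp [hz]))
    simp only [Multiset.card_cons, Multiset.sum_cons, Finsupp.add_apply, add_mul, one_mul, mul_add]
    omega

/-- Minimizers of positive functionals stay minimal in all powers. -/
theorem nsmul_mem_minExp {G : Set Mon} {v w : Fin 2} (hvw : v ≠ w) {p q : ℕ} (hp : 0 < p)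
    (hq : 0 < q) {z : Mon} (hz : z ∈ G)
    (hmin : ∀ y ∈ G, p * z v + q * z w ≤ p * y v + q * y w) (n : ℕ) : n • z ∈ minExp G n := by
  refine ⟨sumsOf_subset_powExp _ _ (nsmul_mem_sumsOf hz n), ?_⟩
  rintro b ⟨_, ⟨s, rfl, hs, rfl⟩, hsb⟩ hb
  have h1 := le_multiset_sum_functional s fun y hy => hmin y (hs y hy)
  have h2 := (mon_le_iff hvw).1 hsb
  have h3 := (mon_le_iff hvw).1 hb
  simp only [Finsupp.smul_apply, smul_eq_mul] at h3
  obtain ⟨c, hc⟩ := Nat.exists_eq_add_of_le (h2.1.trans h3.1)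
  obtain ⟨e, he⟩ := Nat.exists_eq_add_of_le (h2.2.trans h3.2)
  have h4 : p * c + q * e = 0 := by nlinarith
  have hc0 : c = 0 := by
    rcases Nat.eq_zero_or_pos c with h | h
    · exact h
    · have := Nat.mul_pos hp h
      omega
  have he0 : e = 0 := by
    rcases Nat.eq_zero_or_pos e with h | h
    · exact h
    · have := Nat.mul_pos hq h
      omega
  rw [mon_eq_iff hvw]
  simp only [Finsupp.smul_apply, smul_eq_mul]
  omega

variable {I : Ideal (MvPolynomial (Fin 2) K)}

/-- Every positive functional attains its minimum at a persistent generator. -/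
theorem exists_persistentGens_min (hne : (minGens I).Nonempty) {v w : Fin 2} (hvw : v ≠ w)
    {p q : ℕ} (hp : 0 < p) (hq : 0 < q) :
    ∃ f ∈ persistentGens I, ∀ z ∈ minGens I, p * f v + q * f w ≤ p * z v + q * z w := by
  -- Breaking ties by least `v`-degree makes `f` strictly smaller than every other monomial of `I`.
  -- A product of `n` such monomials then cannot divide the `n`-th power of `f`, so `f` is
  -- persistent.
  obtain ⟨f, hf, hmin⟩ := Set.exists_min_image (minGens I)
    (fun z => toLex (p * z v + q * z w, z v)) (minGens_finite I) hne
  have hlex : ∀ z ∈ minGens I, p * f v + q * f w < p * z v + q * z w ∨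
      (p * f v + q * f w = p * z v + q * z w ∧ f v ≤ z v) := fun z hz =>
    Prod.Lex.toLex_le_toLex.1 (hmin z hz)
  refine ⟨f, ⟨hf, ?_⟩, fun z hz => ?_⟩
  · have hstrict : ∀ z, mon K z ∈ I → z ≠ f → p * f v + q * f w < p * z v + q * z w ∨
        (p * f v + q * f w = p * z v + q * z w ∧ f v < z v) := by
      intro z hz hzf
      obtain ⟨b, hb, hbz⟩ := exists_minGens_le hz
      have h1 := hlex b hb
      have h2 := (mon_le_iff hvw).1 hbz
      have h3 := Nat.mul_le_mul_left p h2.1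
      have h4 := Nat.mul_le_mul_left q h2.2
      by_contra! hc
      have h5 : q * z w = q * b w := by omega
      have h6 : p * z v = p * b v := by omega
      have h7 := Nat.eq_of_mul_eq_mul_left hq h5
      have h8 := Nat.eq_of_mul_eq_mul_left hp h6
      have h9 : z v = f v := by omega
      have h10 : q * z w = q * f w := by rw [h9] at hc h6; omega
      exact hzf ((mon_eq_iff hvw).2 ⟨h9, Nat.eq_of_mul_eq_mul_left hq h10⟩)
    rintro a b ha haf hb hbf ⟨n, hn, hmem⟩
    rw [← Set.image_pair, show mon K f ^ n = mon K (n • f) by simp [mon, monomial_pow],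
      mon_mem_span_pow] at hmem
    obtain ⟨_, ⟨s, rfl, hs, rfl⟩, hle⟩ := hmem
    have h1 := multiset_sum_functional s (fun z hz => by
      rcases hs z hz with rfl | rfl
      exacts [hstrict _ ha haf, hstrict _ hb hbf]) (by
      rintro rfl
      simp at hn)
    have h2 := (mon_le_iff hvw).1 hle
    simp only [Finsupp.smul_apply, smul_eq_mul] at h2
    have h3 := Nat.mul_le_mul_left p h2.1
    have h4 := Nat.mul_le_mul_left q h2.2
    rw [mul_left_comm] at h3 h4
    rw [mul_add] at h1
    omega
  · rcases hlex z hz with h | h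
    · exact h.le
    · exact h.1.le

theorem minGens_nonempty (hI : IsMonomialIdeal I) (hnp : ¬Submodule.IsPrincipal I) :
    (minGens I).Nonempty := by
  by_contra h
  rw [Set.not_nonempty_iff_eq_empty] at h
  apply hnp
  rw [hI.eq_span_minGens, h, Set.image_empty, Ideal.span_empty]
  infer_instance

theorem isFrame_of_subset (hI : IsMonomialIdeal I) {m : ℕ} {g : Fin (m + 1) → Mon}
    (hg : ∀ i j, i < j → g j 1 < g i 1) (hP : ∀ i, g i ∈ weaklyPersistentGens I)
    (hsupp : ∀ p q : ℕ, 0 < p → 0 < q →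
      ∃ i, ∀ z ∈ minGens I, p * g i 0 + q * g i 1 ≤ p * z 0 + q * z 1) :
    IsFrame (minGens I) 0 1 g where
  ne := zero_ne_one
  finite := minGens_finite I
  antichain := minGens_antichain I
  mono i j hij := by
    by_contra! hc
    have h1 := hg i j hij
    have := minGens_antichain I _ (hP j).1 _ (hP i).1 ((mon_le_iff zero_ne_one).2 ⟨hc, h1.le⟩)
    rw [this] at h1
    omega
  weak i n hn := by
    rw [← hI.minGens_pow]
    exact (hP i).2 n hn
  mem i := (hP i).1
  support := hsupp

theorem IsAdmissible.isFrame (hI : IsMonomialIdeal I) (hnp : ¬Submodule.IsPrincipal I) {m : ℕ}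
    {g : Fin (m + 1) → Mon} (h : IsAdmissible I g) : IsFrame (minGens I) 0 1 g := by
  obtain ⟨h1, h2, h3⟩ := h
  refine isFrame_of_subset hI h1 (fun i => h3 ⟨i, rfl⟩) fun p q hp hq => ?_
  obtain ⟨f, hf, hmin⟩ :=
    exists_persistentGens_min (minGens_nonempty hI hnp) zero_ne_one hp hq
  obtain ⟨i, rfl⟩ := h2 hf
  exact ⟨i, hmin⟩

/-- Needed where no `P` is given. The generators are listed through their `y`-degrees, which
determine them in an antichain; `Fin.rev` makes the list descending. -/
theorem exists_isFrame (hI : IsMonomialIdeal I) (hnp : ¬Submodule.IsPrincipal I) :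
    ∃ (m : ℕ) (g : Fin (m + 1) → Mon), IsFrame (minGens I) 0 1 g := by
  classical
  have hmin : ∀ p q : ℕ, 0 < p → 0 < q → ∃ f ∈ weaklyPersistentGens I,
      ∀ z ∈ minGens I, p * f 0 + q * f 1 ≤ p * z 0 + q * z 1 := by
    intro p q hp hq
    obtain ⟨f, hf, h⟩ := exists_persistentGens_min (minGens_nonempty hI hnp) zero_ne_one hp hq
    refine ⟨f, ⟨hf.1, fun n _ => ?_⟩, h⟩
    rw [hI.minGens_pow]
    exact nsmul_mem_minExp zero_ne_one hp hq hf.1 h n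
  have hfin : (weaklyPersistentGens I).Finite := (minGens_finite I).subset fun _ h => h.1
  set A : Finset ℕ := hfin.toFinset.image fun f => f 1 with hA
  have hmemA : ∀ n, n ∈ A ↔ ∃ f ∈ weaklyPersistentGens I, f 1 = n := by simp [hA]
  obtain ⟨f₀, hf₀, -⟩ := hmin 1 1 one_pos one_pos
  have hcard : A.card = A.card - 1 + 1 := by
    have : 0 < A.card := Finset.card_pos.2 ⟨f₀ 1, (hmemA _).2 ⟨f₀, hf₀, rfl⟩⟩
    omega
  have hex : ∀ i, ∃ f ∈ weaklyPersistentGens I, f 1 = A.orderEmbOfFin hcard i := fun i =>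
    (hmemA _).1 (A.orderEmbOfFin_mem hcard i)
  choose g hg hgv using hex
  refine ⟨A.card - 1, g ∘ Fin.rev, isFrame_of_subset hI (fun i j hij => ?_) (fun i => hg _) ?_⟩
  · rw [Function.comp_apply, Function.comp_apply, hgv, hgv, OrderEmbedding.lt_iff_lt]
    exact Fin.rev_lt_rev.2 hij
  · intro p q hp hq
    obtain ⟨f, hf, h⟩ := hmin p q hp hq
    have hfA : f 1 ∈ Set.range (A.orderEmbOfFin hcard) := by
      rw [Finset.range_orderEmbOfFin, Finset.mem_coe]
      exact (hmemA _).2 ⟨f, hf, rfl⟩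
    obtain ⟨i, hi⟩ := hfA
    have hfi : g i = f := by
      have h1 : g i 1 = f 1 := (hgv i).trans hi
      rcases le_total (g i 0) (f 0) with h2 | h2
      · exact minGens_antichain I _ (hg i).1 _ hf.1 ((mon_le_iff zero_ne_one).2 ⟨h2, h1.le⟩)
      · exact (minGens_antichain I _ hf.1 _ (hg i).1 ((mon_le_iff zero_ne_one).2 ⟨h2, h1.ge⟩)).symm
    exact ⟨i.rev, by simpa [hfi] using h⟩

/-! ### The invariants of `P` and the explicit bound. -/

namespace IsFrame

variable {v w : Fin 2} {m : ℕ} {g : Fin (m + 1) → Mon}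

theorem pos_of_not_isPrincipal (hF : IsFrame (minGens I) v w g) (hI : IsMonomialIdeal I)
    (hnp : ¬Submodule.IsPrincipal I) : 0 < m := by
  by_contra! h0
  obtain rfl : m = 0 := by omega
  apply hnp
  have : minGens I = {g 0} := Set.eq_singleton_iff_unique_mem.2 ⟨hF.mem 0, fun z hz =>
    hF.eq_of_apply_eq hz (hF.mem 0) (le_antisymm (hF.le_last hz) (hF.zero_le hz))⟩
  rw [hI.eq_span_minGens, this, Set.image_singleton]
  exact ⟨⟨_, rfl⟩⟩

theorem Decomposes.rev {G : Set Mon} {D : ℕ} (h : Decomposes G g D) :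
    Decomposes G (g ∘ Fin.rev) D := by
  intro n f hf
  obtain ⟨i, a, b, hab, u, hu, hle⟩ := h n f hf
  refine ⟨i.rev, b, a, by omega, u, hu, ?_⟩
  simpa [Fin.rev_castSucc, Fin.rev_succ, add_right_comm] using hle

theorem decomposes_bigD (hF : IsFrame (minGens I) 0 1 g) (hm : 0 < m) {D : ℕ}
    (hD : bigD I g ≤ D) : Decomposes (minGens I) g D := by
  -- Truncated subtraction in `delta` and `dOf` is harmless: `n ≤ (n - 1) + 1` and `n ≤ (n - 2) + 2`
  -- always hold.
  refine hF.decomposes hm (δ := delta K g) (d := dOf I m) (fun i => ?_) (fun h2 => ?_) hD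
  · have := Finset.le_sup (f := fun i : Fin m => min (pairDist K 0 (g i.castSucc) (g i.succ))
      (pairDist K 1 (g i.castSucc) (g i.succ))) (Finset.mem_univ i)
    simp only [hF.pairDist_left, hF.pairDist_right] at this
    simp only [delta, hF.pairDist_left, hF.pairDist_right]
    omega
  · rw [dOf, if_pos (by omega), hF.dist_left, hF.dist_right]
    omega

/-- Positivity matters because a quotient by zero counts as 0 in the supremum. -/
theorem le_rDir (D : ℕ) (i : Fin m) (h : 0 < pairDist K v (g i.castSucc) (g i.succ)) :
    D * dist v I ≤ rDir v I g D * pairDist K v (g i.castSucc) (g i.succ) := by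
  have h1 := Finset.le_sup (f := fun i : Fin m =>
    (dist v I : ℚ≥0) / (pairDist K v (g i.castSucc) (g i.succ) : ℚ≥0)) (Finset.mem_univ i)
  have h2 : (D : ℚ≥0) * ((dist v I : ℚ≥0) / (pairDist K v (g i.castSucc) (g i.succ) : ℚ≥0)) ≤
      rDir v I g D := (mul_le_mul_right h1 _).trans (Nat.le_ceil _)
  rw [← mul_div_assoc, div_le_iff₀ (by exact_mod_cast h)] at h2
  exact_mod_cast h2

theorem rDir_le (D : ℕ) {c : ℕ}
    (h : ∀ i : Fin m, dist v I ≤ c * pairDist K v (g i.castSucc) (g i.succ))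
    (hpos : ∀ i : Fin m, 0 < pairDist K v (g i.castSucc) (g i.succ)) :
    rDir v I g D ≤ D * c := by
  refine Nat.ceil_le.2 ?_
  rw [Nat.cast_mul]
  refine mul_le_mul_right (Finset.sup_le fun i _ => ?_) _
  rw [div_le_iff₀ (by exact_mod_cast hpos i)]
  exact_mod_cast h i

theorem mu_linear (hF : IsFrame (minGens I) 0 1 g) (hI : IsMonomialIdeal I) (hm : 0 < m) {D : ℕ}
    (hD : bigD I g ≤ D) {s : ℕ} (hs : D + rMin I g D + 1 ≤ s) (l : ℕ) :
    (mu (I ^ (s + l)) : ℤ) = mu (I ^ s) + l * ((mu (I ^ (s + 1)) : ℤ) - mu (I ^ s)) := by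
  have hdec := hF.decomposes_bigD hm hD
  have hlt : ∀ i : Fin m, i.castSucc < i.succ := fun i => Fin.castSucc_lt_succ
  refine linear_of_second_difference (fun n => mu (I ^ n)) (s := s) (fun t ht => ?_) l
  simp only [mu, hI.minGens_pow]
  -- The count runs in whichever direction attains the minimum; for `y` the frame is reversed.
  rcases min_choice (rDir 0 I g D) (rDir 1 I g D) with h | h <;> rw [rMin, h] at hs
  · refine hF.ncard_second_difference hdec (r := rDir 0 I g D) (fun i => ?_) (by omega)
    rw [← hF.dist_left, ← hF.pairDist_left]
    refine le_rDir D i ?_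
    rw [hF.pairDist_left]
    exact Nat.sub_pos_of_lt (hF.mono (hlt i))
  · refine hF.swap.ncard_second_difference (Decomposes.rev hdec) (r := rDir 1 I g D) (fun i => ?_)
      (by omega)
    rw [← hF.swap.dist_left]
    simp only [Function.comp_apply, Fin.rev_castSucc, Fin.rev_succ]
    rw [← hF.pairDist_right]
    refine le_rDir D i.rev ?_
    rw [hF.pairDist_right]
    exact Nat.sub_pos_of_lt (hF.anti (hlt _))

theorem pairDist_bounds (hF : IsFrame (minGens I) 0 1 g) (u : Fin 2) (i : Fin m) :
    0 < pairDist K u (g i.castSucc) (g i.succ) ∧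
      pairDist K u (g i.castSucc) (g i.succ) ≤ dist u I ∧
      (m = 1 → pairDist K u (g i.castSucc) (g i.succ) = dist u I) ∧
      (2 ≤ m → pairDist K u (g i.castSucc) (g i.succ) < dist u I) := by
  have hlt : i.castSucc < i.succ := Fin.castSucc_lt_succ
  have hm1 : m = 1 → i.castSucc = 0 ∧ i.succ = Fin.last m := by
    rintro rfl
    exact ⟨Subsingleton.elim i 0 ▸ rfl, Subsingleton.elim i 0 ▸ rfl⟩
  have hm2 : 2 ≤ m → 0 < i.castSucc ∨ i.succ < Fin.last m := fun h => by
    simp only [Fin.lt_def, Fin.val_zero, Fin.val_castSucc, Fin.val_succ, Fin.val_last]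
    have := i.isLt
    omega
  rcases eq_or_eq_of_ne zero_ne_one u with rfl | rfl
  · rw [hF.pairDist_left, hF.dist_left]
    have h1 : g i.castSucc 0 < g i.succ 0 := hF.mono hlt
    have h2 : g 0 0 ≤ g i.castSucc 0 := hF.mono.monotone (Fin.zero_le _)
    have h3 : g i.succ 0 ≤ g (Fin.last m) 0 := hF.mono.monotone (Fin.le_last _)
    refine ⟨by omega, by omega, fun h => ?_, fun h => ?_⟩
    · rw [(hm1 h).1, (hm1 h).2]
    · rcases hm2 h with h | h
      · have : g 0 0 < g i.castSucc 0 := hF.mono h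
        omega
      · have : g i.succ 0 < g (Fin.last m) 0 := hF.mono h
        omega
  · rw [hF.pairDist_right, hF.dist_right]
    have h1 := hF.anti hlt
    have h2 : g i.castSucc 1 ≤ g 0 1 := by
      rcases (Fin.zero_le i.castSucc).eq_or_lt with h | h
      · rw [← h]
      · exact (hF.anti h).le
    have h3 : g (Fin.last m) 1 ≤ g i.succ 1 := by
      rcases (Fin.le_last i.succ).eq_or_lt with h | h
      · rw [← h]
      · exact (hF.anti h).le
    refine ⟨by omega, by omega, fun h => ?_, fun h => ?_⟩
    · rw [(hm1 h).1, (hm1 h).2]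
    · rcases hm2 h with h | h
      · have := hF.anti h
        omega
      · have := hF.anti h
        omega

theorem bigD_add_rDir_le (hF : IsFrame (minGens I) 0 1 g) (hm : 0 < m) (u : Fin 2) :
    bigD I g + rDir u I g (bigD I g) + 1 ≤ mu I * (dist u I ^ 2 - 1) + 1 := by
  have hb := hF.pairDist_bounds u
  have hmu : m + 1 ≤ mu I := by
    have := Set.ncard_le_ncard (s := Set.range g) (t := minGens I)
      (by rintro _ ⟨i, rfl⟩; exact hF.mem i) hF.finite
    rwa [Set.ncard_range_of_injective hF.injective, Nat.card_eq_fintype_card,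
      Fintype.card_fin] at this
  have hdelta : ∀ c, (∀ i : Fin m, pairDist K u (g i.castSucc) (g i.succ) ≤ c) →
      delta K g ≤ c - 1 := fun c hc => by
    refine Nat.sub_le_sub_right (Finset.sup_le fun i _ => ?_) 1
    have := hc i
    rcases eq_or_eq_of_ne zero_ne_one u with rfl | rfl <;> omega
  obtain ⟨x, hx⟩ : ∃ x, dist u I = x + 1 := by
    have := hb ⟨0, hm⟩
    exact ⟨dist u I - 1, by omega⟩
  have hsq : (x + 1) ^ 2 - 1 = x * (x + 2) := by
    rw [show (x + 1) ^ 2 = x * (x + 2) + 1 by ring, Nat.add_sub_cancel]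
  refine Nat.add_le_add_right ?_ 1
  -- For `m = 1` the pair spans all of `I`, so `r ≤ D ≤ μ x` and `2 x ≤ x (x + 2)`. For `m ≥ 2` each
  -- pair is strictly shorter than `I`, so `δ` and `d` are at most `y = dist - 2`, `r ≤ D * dist`,
  -- and `y (dist + 1) ≤ dist ^ 2 - 1`.
  rcases (show m = 1 ∨ 2 ≤ m by omega) with hm1 | hm2
  · have h1 : delta K g ≤ x := by
      have := hdelta (x + 1) fun i => by rw [← hx]; exact (hb i).2.1
      omega
    have h2 : bigD I g ≤ mu I * x := by
      rw [bigD, dOf, if_neg (by omega)]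
      exact Nat.mul_le_mul (by omega) h1
    have h3 : rDir u I g (bigD I g) ≤ bigD I g * 1 :=
      rDir_le _ (fun i => by rw [one_mul, (hb i).2.2.1 hm1]) fun i => (hb i).1
    calc bigD I g + rDir u I g (bigD I g) ≤ mu I * x * 2 := by omega
      _ ≤ mu I * (dist u I ^ 2 - 1) := by
        rw [hx, hsq, mul_assoc]
        gcongr
        omega
  · obtain ⟨y, rfl⟩ : ∃ y, x = y + 1 := by
      have := hb ⟨0, hm⟩
      exact ⟨x - 1, by omega⟩
    have h1 : delta K g ≤ y := by
      have := hdelta (y + 1) fun i => by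
        have := (hb i).2.2.2 hm2
        omega
      omega
    have h0 : dOf I m ≤ y := by
      rw [dOf, if_pos (by omega)]
      rcases eq_or_eq_of_ne zero_ne_one u with rfl | rfl <;> omega
    have h2 : bigD I g ≤ mu I * y := by
      calc bigD I g ≤ (mu I - (m + 1)) * y + (m + 1) * y :=
            Nat.add_le_add (Nat.mul_le_mul le_rfl h1) (Nat.mul_le_mul le_rfl h0)
        _ = mu I * y := by rw [← add_mul, Nat.sub_add_cancel hmu]
    have h3 : rDir u I g (bigD I g) ≤ bigD I g * dist u I :=
      rDir_le _ (fun i => Nat.le_mul_of_pos_right _ (hb i).1) fun i => (hb i).1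
    calc bigD I g + rDir u I g (bigD I g) ≤ bigD I g * (dist u I + 1) := by
          rw [mul_add, mul_one]; omega
      _ ≤ mu I * y * (dist u I + 1) := Nat.mul_le_mul h2 le_rfl
      _ ≤ mu I * (dist u I ^ 2 - 1) := by
        rw [hx, hsq, mul_assoc]
        gcongr
        · omega

end IsFrame

end BivariateMonomial

theorem corollary5 {K : Type*} [Field K] (I : Ideal (MvPolynomial (Fin 2) K))
    (hI : BivariateMonomial.IsMonomialIdeal I) (hnp : ¬ Submodule.IsPrincipal I) :
    (∀ (m : ℕ) (g : Fin (m + 1) → BivariateMonomial.Mon), BivariateMonomial.IsAdmissible I g →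
      (∀ D : ℕ, BivariateMonomial.bigD I g ≤ D →
        ∀ s : ℕ, D + BivariateMonomial.rMin I g D + 1 ≤ s →
          ∀ l : ℕ, (BivariateMonomial.mu (I ^ (s + l)) : ℤ) =
            BivariateMonomial.mu (I ^ s) +
              l * ((BivariateMonomial.mu (I ^ (s + 1)) : ℤ) - BivariateMonomial.mu (I ^ s))) ∧
      (∀ v : Fin 2,
        BivariateMonomial.bigD I g +
            BivariateMonomial.rDir v I g (BivariateMonomial.bigD I g) + 1 ≤
          BivariateMonomial.mu I * (BivariateMonomial.dist v I ^ 2 - 1) + 1)) ∧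
    (∀ v : Fin 2, ∀ s : ℕ,
      BivariateMonomial.mu I * (BivariateMonomial.dist v I ^ 2 - 1) + 1 ≤ s →
        ∀ l : ℕ, (BivariateMonomial.mu (I ^ (s + l)) : ℤ) =
          BivariateMonomial.mu (I ^ s) +
            l * ((BivariateMonomial.mu (I ^ (s + 1)) : ℤ) - BivariateMonomial.mu (I ^ s))) := by
  refine ⟨fun m g hg => ?_, fun v s hs l => ?_⟩
  · have hF := hg.isFrame hI hnp
    have hm := hF.pos_of_not_isPrincipal hI hnp
    exact ⟨fun D hD s hs l => hF.mu_linear hI hm hD hs l, fun v => hF.bigD_add_rDir_le hm v⟩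
  · obtain ⟨m, g, hF⟩ := BivariateMonomial.exists_isFrame hI hnp
    have hm := hF.pos_of_not_isPrincipal hI hnp
    refine hF.mu_linear hI hm le_rfl (le_trans ?_ hs) l
    refine le_trans (Nat.add_le_add_right (Nat.add_le_add_left ?_ _) 1) (hF.bigD_add_rDir_le hm v)
    rcases BivariateMonomial.eq_or_eq_of_ne zero_ne_one v with rfl | rfl
    · exact min_le_left _ _
    · exact min_le_right _ _
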